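/- Let $p$ be a prime, $S$ a finite $p$-group, and $\mathcal F$ a saturated fusion system on $S$. Let $A(S)$ be the Burnside ring of $S$, i.e. the Grothendieck ring of the semiring of isomorphism classes of finite $S$-sets (with disjoint union as addition and cartesian product as multiplication), and for $Q\le S$ let $\Phi_Q\colon A(S)\to\mathbb Z$ be the ring homomorphism with $\Phi_Q([X])=|X^Q|$ for every finite $S$-set $X$. Let $A(\mathcal F)\subseteq A(S)$ be the subring of $\mathcal F$-stable elements, i.e. of those $X\in A(S)$ such that for every $P\le S$ and every morphism $\varphi\colon P\to S$ of $\mathcal F$, the restrictions of $X$ to $A(P)$ along $\varphi$ and along the inclusion $P\le S$ agree. Write $(-)_{(p)}$ for $p$-localization (inverting the integers prime to $p$), regard $A(\mathcal F)_{(p)}$ as a subring of $A(S)_{(p)}$, and write $\Phi_Q\colon A(S)_{(p)}\to\mathbb Z_{(p)}\subseteq\mathbb Q$ also for the induced homomorphism. For $Q\le S$ let $[Q]_{\mathcal F}$ be the set of subgroups of $S$ that are $\mathcal F$-conjugate to $Q$. Then for each $X\in A(S)_{(p)}$ there is an element $\pi(X)\in A(\mathcal F)_{(p)}$ such that $$\Phi_Q(\pi(X))=\frac1{|[Q]_{\mathcal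 F}|}\sum_{Q'\in[Q]_{\mathcal F}}\Phi_{Q'}(X)\qquad\text{for all }Q\le S,$$ and $\pi(X)$ is the only element of $A(S)_{(p)}$ with these marks. The resulting map $\pi\colon A(S)_{(p)}\to A(\mathcal F)_{(p)}$ is a homomorphism of $A(\mathcal F)_{(p)}$-modules and restricts to the identity on $A(\mathcal F)_{(p)}$. -/

import Mathlib

universe u

noncomputable section

/-! ### The Grothendieck ring of a commutative semiring -/

/-- The Grothendieck ring of a commutative semiring: the Grothendieck group of its additive monoid,
with the multiplication extended biadditively. -/
def GrothendieckRing (R : Type*) [CommSemiring R] : Type _ := Algebra.GrothendieckAddGroup R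

namespace GrothendieckRing

variable {R : Type*} [CommSemiring R]

instance : AddCommGroup (GrothendieckRing R) :=
  inferInstanceAs (AddCommGroup (Algebra.GrothendieckAddGroup R))

/-- The canonical map to the Grothendieck ring, as an additive map. -/
def ofAdd : R →+ GrothendieckRing R := (Algebra.GrothendieckAddGroup.of : R →+ _)

/-- The universal property of the additive group. -/
def liftAdd {B : Type*} [AddCommGroup B] (f : R →+ B) : GrothendieckRing R →+ B :=
  Algebra.GrothendieckAddGroup.lift f

theorem liftAdd_of {B : Type*} [AddCommGroup B] (f : R →+ B) (a : R) :
    liftAdd f (ofAdd a) = f a :=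
  DFunLike.congr_fun (Algebra.GrothendieckAddGroup.lift.symm_apply_apply f) a

theorem hom_ext {B : Type*} [AddCommGroup B] {f g : GrothendieckRing R →+ B}
    (h : ∀ a, f (ofAdd a) = g (ofAdd a)) : f = g :=
  Algebra.GrothendieckAddGroup.lift.symm.injective (DFunLike.ext _ _ h)

/-- Every element is a difference of two elements of the semiring. -/
theorem exists_sub (x : GrothendieckRing R) : ∃ a b : R, x = ofAdd a - ofAdd b := by
  let H : AddSubgroup (GrothendieckRing R) :=
    { carrier := {x | ∃ a b : R, x = ofAdd a - ofAdd b}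
      zero_mem' := ⟨0, 0, by simp⟩
      add_mem' := by
        rintro _ _ ⟨a, b, rfl⟩ ⟨c, d, rfl⟩
        exact ⟨a + c, b + d, by simp only [map_add]; abel⟩
      neg_mem' := by
        rintro _ ⟨a, b, rfl⟩
        exact ⟨b, a, by abel⟩ }
  have h : QuotientAddGroup.mk' H = 0 := hom_ext fun a =>
    (QuotientAddGroup.eq_zero_iff _).2 ⟨a, 0, by simp⟩
  exact (QuotientAddGroup.eq_zero_iff x).1 (DFunLike.congr_fun h x)

/-- The biadditive extension of the multiplication. -/
def mulHom : GrothendieckRing R →+ GrothendieckRing R →+ GrothendieckRing R :=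
  liftAdd
    { toFun := fun a => liftAdd (ofAdd.comp (AddMonoidHom.mulLeft a))
      map_zero' := hom_ext fun b => by simp [liftAdd_of]
      map_add' := fun a a' => hom_ext fun b => by simp [liftAdd_of, add_mul] }

theorem mulHom_of (a b : R) : mulHom (ofAdd a) (ofAdd b) = ofAdd (a * b) := by
  rw [mulHom, liftAdd_of]
  exact liftAdd_of _ _

instance : Mul (GrothendieckRing R) := ⟨fun x y => mulHom x y⟩

instance : One (GrothendieckRing R) := ⟨ofAdd 1⟩

theorem of_mul_of (a b : R) : (ofAdd a * ofAdd b : GrothendieckRing R) = ofAdd (a * b) :=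
  mulHom_of a b

theorem mul_add_aux (x y z : GrothendieckRing R) : x * (y + z) = x * y + x * z :=
  map_add (mulHom x) y z

theorem add_mul_aux (x y z : GrothendieckRing R) : (x + y) * z = x * z + y * z :=
  DFunLike.congr_fun (map_add mulHom x y) z

theorem mul_sub_aux (x y z : GrothendieckRing R) : x * (y - z) = x * y - x * z :=
  map_sub (mulHom x) y z

theorem sub_mul_aux (x y z : GrothendieckRing R) : (x - y) * z = x * z - y * z :=
  DFunLike.congr_fun (map_sub mulHom x y) z

instance : CommRing (GrothendieckRing R) where
  __ := (inferInstance : AddCommGroup (GrothendieckRing R))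
  left_distrib := mul_add_aux
  right_distrib := add_mul_aux
  zero_mul x := DFunLike.congr_fun (map_zero mulHom) x
  mul_zero x := map_zero (mulHom x)
  mul_assoc x y z := by
    obtain ⟨a, b, rfl⟩ := exists_sub x
    obtain ⟨c, d, rfl⟩ := exists_sub y
    obtain ⟨e, f, rfl⟩ := exists_sub z
    simp only [mul_sub_aux, sub_mul_aux, of_mul_of, mul_assoc]
  one_mul x := by
    obtain ⟨a, b, rfl⟩ := exists_sub x
    change ofAdd 1 * (_ : GrothendieckRing R) = _
    simp only [mul_sub_aux, of_mul_of, one_mul]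
  mul_one x := by
    obtain ⟨a, b, rfl⟩ := exists_sub x
    change (_ : GrothendieckRing R) * ofAdd 1 = _
    simp only [sub_mul_aux, of_mul_of, mul_one]
  mul_comm x y := by
    obtain ⟨a, b, rfl⟩ := exists_sub x
    obtain ⟨c, d, rfl⟩ := exists_sub y
    simp only [mul_sub_aux, sub_mul_aux, of_mul_of, mul_comm]
    abel

/-- The canonical semiring homomorphism to the Grothendieck ring. -/
def of : R →+* GrothendieckRing R :=
  { ofAdd with
    map_one' := rfl
    map_mul' := fun a b => (of_mul_of a b).symm }

/-- The universal property of the Grothendieck ring. -/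
def lift {B : Type*} [CommRing B] (f : R →+* B) : GrothendieckRing R →+* B :=
  { liftAdd (f : R →+ B) with
    map_one' := (liftAdd_of (f : R →+ B) 1).trans (map_one f)
    map_mul' := fun x y => by
      obtain ⟨a, b, rfl⟩ := exists_sub x
      obtain ⟨c, d, rfl⟩ := exists_sub y
      change liftAdd (f : R →+ B) _ = liftAdd (f : R →+ B) _ * liftAdd (f : R →+ B) _
      simp only [mul_sub_aux, sub_mul_aux, of_mul_of, map_sub, liftAdd_of,
        AddMonoidHom.coe_coe, map_mul]
      ring }

theorem lift_of {B : Type*} [CommRing B] (f : R →+* B) (a : R) : lift f (of a) = f a :=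
  liftAdd_of (f : R →+ B) a

end GrothendieckRing

/-! ### The Burnside ring of a group -/

/-- A finite set with an action of the group `G`. -/
structure FinGSet (G : Type u) [Group G] : Type (u + 1) where
  carrier : Type u
  [finite : Finite carrier]
  [action : MulAction G carrier]

attribute [instance] FinGSet.finite FinGSet.action

namespace FinGSet

variable {G : Type u} [Group G]

/-- Isomorphism of `G`-sets. -/
def IsIso (X Y : FinGSet G) : Prop :=
  ∃ e : X.carrier ≃ Y.carrier, ∀ (g : G) (x : X.carrier), e (g • x) = g • e x

instance setoid (G : Type u) [Group G] : Setoid (FinGSet G) where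
  r := IsIso
  iseqv :=
    { refl := fun _ => ⟨Equiv.refl _, fun _ _ => rfl⟩
      symm := by
        rintro X Y ⟨e, he⟩
        exact ⟨e.symm, fun g y => by
          rw [Equiv.symm_apply_eq, he, Equiv.apply_symm_apply]⟩
      trans := by
        rintro X Y Z ⟨e, he⟩ ⟨f, hf⟩
        exact ⟨e.trans f, fun g x => by simp [he, hf]⟩ }

/-- The empty `G`-set. -/
def empty (G : Type u) [Group G] : FinGSet G :=
  letI : MulAction G PEmpty.{u + 1} :=
    { smul := fun _ x => x, one_smul := fun _ => rfl, mul_smul := fun _ _ _ => rfl }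
  ⟨PEmpty.{u + 1}⟩

/-- The one-point `G`-set. -/
def point (G : Type u) [Group G] : FinGSet G := ⟨PUnit.{u + 1}⟩

/-- Disjoint union. -/
def sum (X Y : FinGSet G) : FinGSet G := ⟨X.carrier ⊕ Y.carrier⟩

/-- Cartesian product with the diagonal action. -/
def prod (X Y : FinGSet G) : FinGSet G := ⟨X.carrier × Y.carrier⟩

/-- Restriction of the action along a group homomorphism `f`, i.e. `g • x := f g • x`. -/
def res {H : Type u} [Group H] (f : H →* G) (X : FinGSet G) : FinGSet H :=
  letI : MulAction H X.carrier := MulAction.compHom X.carrier f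
  ⟨X.carrier⟩

/-- The number of fixed points of the subgroup `P`. -/
def fixCard (P : Subgroup G) (X : FinGSet G) : ℕ := Nat.card (MulAction.fixedPoints P X.carrier)

end FinGSet

/-- Isomorphism classes of finite `G`-sets. -/
def FinGSetClass (G : Type u) [Group G] : Type (u + 1) := Quotient (FinGSet.setoid G)

namespace FinGSetClass

variable {G : Type u} [Group G]

instance : Add (FinGSetClass G) :=
  ⟨Quotient.map₂ FinGSet.sum (by
    rintro X X' ⟨e, he⟩ Y Y' ⟨f, hf⟩
    refine ⟨Equiv.sumCongr e f, ?_⟩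
    rintro g (x | y)
    · exact congrArg Sum.inl (he g x)
    · exact congrArg Sum.inr (hf g y))⟩

instance : Mul (FinGSetClass G) :=
  ⟨Quotient.map₂ FinGSet.prod (by
    rintro X X' ⟨e, he⟩ Y Y' ⟨f, hf⟩
    exact ⟨Equiv.prodCongr e f, fun g x => Prod.ext (he g x.1) (hf g x.2)⟩)⟩

instance : Zero (FinGSetClass G) := ⟨Quotient.mk _ (FinGSet.empty G)⟩

instance : One (FinGSetClass G) := ⟨Quotient.mk _ (FinGSet.point G)⟩

/-- Isomorphism classes of finite `G`-sets form a commutative semiring under disjoint union and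
cartesian product. -/
instance : CommSemiring (FinGSetClass G) where
  add_assoc := by
    rintro ⟨X⟩ ⟨Y⟩ ⟨Z⟩
    refine Quotient.sound ⟨Equiv.sumAssoc _ _ _, ?_⟩
    rintro g ((x | x) | x) <;> rfl
  zero_add := by
    rintro ⟨X⟩
    refine Quotient.sound ⟨Equiv.emptySum PEmpty _, ?_⟩
    rintro g (x | x)
    · exact x.elim
    · rfl
  add_zero := by
    rintro ⟨X⟩
    refine Quotient.sound ⟨Equiv.sumEmpty _ PEmpty, ?_⟩
    rintro g (x | x)
    · rfl
    · exact x.elim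
  add_comm := by
    rintro ⟨X⟩ ⟨Y⟩
    refine Quotient.sound ⟨Equiv.sumComm _ _, ?_⟩
    rintro g (x | x) <;> rfl
  mul_assoc := by
    rintro ⟨X⟩ ⟨Y⟩ ⟨Z⟩
    exact Quotient.sound ⟨Equiv.prodAssoc _ _ _, fun _ _ => rfl⟩
  mul_comm := by
    rintro ⟨X⟩ ⟨Y⟩
    exact Quotient.sound ⟨Equiv.prodComm _ _, fun _ _ => rfl⟩
  one_mul := by
    rintro ⟨X⟩
    exact Quotient.sound ⟨Equiv.punitProd _, fun _ _ => rfl⟩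
  mul_one := by
    rintro ⟨X⟩
    exact Quotient.sound ⟨Equiv.prodPUnit _, fun _ _ => rfl⟩
  zero_mul := by
    rintro ⟨X⟩
    exact Quotient.sound ⟨Equiv.pemptyProd _, fun _ x => x.1.elim⟩
  mul_zero := by
    rintro ⟨X⟩
    exact Quotient.sound ⟨Equiv.prodPEmpty _, fun _ x => x.2.elim⟩
  left_distrib := by
    rintro ⟨X⟩ ⟨Y⟩ ⟨Z⟩
    refine Quotient.sound ⟨Equiv.prodSumDistrib _ _ _, ?_⟩
    rintro g ⟨x, y | y⟩ <;> rfl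
  right_distrib := by
    rintro ⟨X⟩ ⟨Y⟩ ⟨Z⟩
    refine Quotient.sound ⟨Equiv.sumProdDistrib _ _ _, ?_⟩
    rintro g ⟨x | x, y⟩ <;> rfl
  nsmul := nsmulRec

/-- Restriction along a group homomorphism, on isomorphism classes. -/
def res {H : Type u} [Group H] (f : H →* G) : FinGSetClass G →+* FinGSetClass H where
  toFun := Quotient.map (FinGSet.res f) (by
    rintro X Y ⟨e, he⟩
    exact ⟨e, fun h x => he (f h) x⟩)
  map_one' := Quotient.sound ⟨Equiv.refl _, fun _ _ => rfl⟩
  map_zero' := Quotient.sound ⟨Equiv.refl _, fun _ _ => rfl⟩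
  map_mul' := by
    rintro ⟨X⟩ ⟨Y⟩
    exact Quotient.sound ⟨Equiv.refl _, fun _ _ => rfl⟩
  map_add' := by
    rintro ⟨X⟩ ⟨Y⟩
    refine Quotient.sound ⟨Equiv.refl _, ?_⟩
    rintro g (x | x) <;> rfl

/-- The number of fixed points of the subgroup `P`, on isomorphism classes. -/
def mark (P : Subgroup G) : FinGSetClass G →+* ℕ where
  toFun := Quotient.lift (FinGSet.fixCard P) (by
    rintro X Y ⟨e, he⟩
    refine Nat.card_congr (e.subtypeEquiv fun x => forall_congr' fun g => ?_)
    exact e.injective.eq_iff.symm.trans (Eq.congr_left (he g x)))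
  map_one' := by
    refine (Nat.card_congr (Equiv.subtypeUnivEquiv fun x => ?_)).trans
      (Nat.card_unique (α := PUnit.{u + 1}))
    exact fun _ => rfl
  map_zero' :=
    haveI : IsEmpty (MulAction.fixedPoints P (FinGSet.empty G).carrier) := ⟨fun x => x.1.elim⟩
    Nat.card_of_isEmpty
  map_mul' := by
    rintro ⟨X⟩ ⟨Y⟩
    refine (Nat.card_congr ?_).trans (Nat.card_prod (MulAction.fixedPoints P X.carrier)
      (MulAction.fixedPoints P Y.carrier))
    exact
      { toFun := fun z => (⟨z.1.1, fun g => congrArg Prod.fst (z.2 g)⟩,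
          ⟨z.1.2, fun g => congrArg Prod.snd (z.2 g)⟩)
        invFun := fun z => ⟨(z.1.1, z.2.1), fun g => Prod.ext (z.1.2 g) (z.2.2 g)⟩
        left_inv := fun _ => rfl
        right_inv := fun _ => rfl }
  map_add' := by
    rintro ⟨X⟩ ⟨Y⟩
    refine (Nat.card_congr ?_).trans (Nat.card_sum (α := MulAction.fixedPoints P X.carrier)
      (β := MulAction.fixedPoints P Y.carrier))
    exact
      { toFun := fun z => match z with
          | ⟨Sum.inl x, h⟩ => Sum.inl ⟨x, fun g => Sum.inl_injective (h g)⟩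
          | ⟨Sum.inr y, h⟩ => Sum.inr ⟨y, fun g => Sum.inr_injective (h g)⟩
        invFun := fun z => match z with
          | Sum.inl x => ⟨Sum.inl x.1, fun g => congrArg Sum.inl (x.2 g)⟩
          | Sum.inr y => ⟨Sum.inr y.1, fun g => congrArg Sum.inr (y.2 g)⟩
        left_inv := by rintro ⟨x | y, h⟩ <;> rfl
        right_inv := by rintro (x | y) <;> rfl }

end FinGSetClass

/-- The Burnside ring `A(G)`: the Grothendieck ring of the semiring of isomorphism classes of finite
`G`-sets. -/
abbrev BurnsideRing (G : Type u) [Group G] : Type (u + 1) := GrothendieckRing (FinGSetClass G)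

namespace BurnsideRing

variable {G : Type u} [Group G]

/-- The restriction homomorphism `A(G) → A(H)` along a group homomorphism `H → G`. -/
def res {H : Type u} [Group H] (f : H →* G) : BurnsideRing G →+* BurnsideRing H :=
  GrothendieckRing.lift (GrothendieckRing.of.comp (FinGSetClass.res f))

/-- The mark homomorphism `Φ_P : A(G) → ℤ`, with `Φ_P [X] = |X^P|` for every finite `G`-set `X`. -/
def mark (P : Subgroup G) : BurnsideRing G →+* ℤ :=
  GrothendieckRing.lift ((Nat.castRingHom ℤ).comp (FinGSetClass.mark P))

end BurnsideRing

/-! ### `p`-localization -/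

/-- The integers that are not divisible by `p`. -/
def primeToP (p : ℕ) [hp : Fact p.Prime] : Submonoid ℤ where
  carrier := {n | ¬ (p : ℤ) ∣ n}
  one_mem' := (Nat.prime_iff_prime_int.1 hp.out).not_dvd_one
  mul_mem' ha hb := (Nat.prime_iff_prime_int.1 hp.out).not_dvd_mul ha hb

/-- The `p`-localization `A_(p)` of a commutative ring `A`: the integers prime to `p` are
inverted. -/
abbrev PLocal (p : ℕ) [Fact p.Prime] (A : Type*) [CommRing A] : Type _ :=
  Localization (Algebra.algebraMapSubmonoid A (primeToP p))

theorem algebraMapSubmonoid_primeToP_le (p : ℕ) [Fact p.Prime] {A B : Type*} [CommRing A]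
    [CommRing B] (f : A →+* B) :
    Algebra.algebraMapSubmonoid A (primeToP p) ≤
      (Algebra.algebraMapSubmonoid B (primeToP p)).comap f := by
  rintro _ ⟨n, hn, rfl⟩
  exact ⟨n, hn, by simp⟩

/-- The homomorphism `A_(p) → B_(p)` induced by `A → B`. -/
def PLocal.map (p : ℕ) [Fact p.Prime] {A B : Type*} [CommRing A] [CommRing B] (f : A →+* B) :
    PLocal p A →+* PLocal p B :=
  IsLocalization.map (PLocal p B) f (algebraMapSubmonoid_primeToP_le p f)

theorem PLocal.map_injective (p : ℕ) [Fact p.Prime] {A B : Type*} [CommRing A] [CommRing B]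
    (f : A →+* B) (hf : Function.Injective f) : Function.Injective (PLocal.map p f) := by
  have h : Algebra.algebraMapSubmonoid B (primeToP p) =
      (Algebra.algebraMapSubmonoid A (primeToP p)).map f := by
    ext x
    simp [Algebra.algebraMapSubmonoid]
  rw [injective_iff_map_eq_zero]
  intro x hx
  obtain ⟨⟨a, s⟩, rfl⟩ := IsLocalization.mk'_surjective
    (Algebra.algebraMapSubmonoid A (primeToP p)) x
  rw [PLocal.map, IsLocalization.map_mk', IsLocalization.mk'_eq_zero_iff] at hx
  obtain ⟨⟨_, t⟩, ht⟩ := hx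
  rw [h] at t
  obtain ⟨m, hm, rfl⟩ := t
  rw [IsLocalization.mk'_eq_zero_iff]
  exact ⟨⟨m, hm⟩, hf (by simpa using ht)⟩

/-- The mark homomorphism `Φ_P` on `A(G)_(p)`. Its values lie in `ℤ_(p)`; they are regarded as
rational numbers. -/
def BurnsideRing.pMark (p : ℕ) [Fact p.Prime] {G : Type u} [Group G] (P : Subgroup G) :
    PLocal p (BurnsideRing G) →+* ℚ :=
  IsLocalization.lift (M := Algebra.algebraMapSubmonoid (BurnsideRing G) (primeToP p))
    (g := (Int.castRingHom ℚ).comp (BurnsideRing.mark P)) (by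
      rintro ⟨_, n, hn, rfl⟩
      have h : n ≠ 0 := by
        rintro rfl
        exact hn (dvd_zero _)
      simpa using h)

/-! ### Fusion systems -/

/-- The conjugation homomorphism `c_s : P → Q`, `x ↦ s x s⁻¹`, when `s P s⁻¹ ≤ Q`. -/
def conjHom {S : Type u} [Group S] (P Q : Subgroup S) (s : S) (h : ∀ x ∈ P, s * x * s⁻¹ ∈ Q) :
    P →* Q where
  toFun x := ⟨s * x * s⁻¹, h x x.2⟩
  map_one' := Subtype.ext (by simp)
  map_mul' x y := Subtype.ext (by simp)

/-- The image `φ(P)` of a homomorphism `φ : P → Q`, as a subgroup of `S`. -/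
abbrev homImage {S : Type u} [Group S] {P Q : Subgroup S} (φ : P →* Q) : Subgroup S :=
  (Q.subtype.comp φ).range

/-- A homomorphism `φ : P → Q` regarded as a homomorphism `P → φ(P)`. -/
abbrev toHomImage {S : Type u} [Group S] {P Q : Subgroup S} (φ : P →* Q) : P →* homImage φ :=
  (Q.subtype.comp φ).rangeRestrict

/-- A fusion system on a group `S`: a category whose objects are the subgroups of `S` and whose
morphisms are injective group homomorphisms. Identities are conjugations by `1`. -/
structure FusionSystem (S : Type u) [Group S] where
  /-- The set of morphisms from `P` to `Q`. -/
  hom : ∀ P Q : Subgroup S, Set (P →* Q)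
  injective : ∀ {P Q : Subgroup S} {φ : P →* Q}, φ ∈ hom P Q → Function.Injective φ
  comp_mem : ∀ {P Q R : Subgroup S} {φ : P →* Q} {ψ : Q →* R},
    φ ∈ hom P Q → ψ ∈ hom Q R → ψ.comp φ ∈ hom P R
  conj_mem : ∀ (P Q : Subgroup S) (s : S) (h : ∀ x ∈ P, s * x * s⁻¹ ∈ Q),
    conjHom P Q s h ∈ hom P Q
  toImage_mem : ∀ {P Q : Subgroup S} {φ : P →* Q}, φ ∈ hom P Q →
    toHomImage φ ∈ hom P (homImage φ)
  /-- The inverse `φ(P) → P` of a morphism is a morphism. -/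
  inv_mem : ∀ {P Q : Subgroup S} {φ : P →* Q} (hφ : φ ∈ hom P Q),
    (MonoidHom.ofInjective (f := Q.subtype.comp φ)
      (Q.subtype_injective.comp (injective hφ))).symm.toMonoidHom ∈ hom (homImage φ) P

namespace FusionSystem

variable {S : Type u} [Group S] (F : FusionSystem S)

/-- `P` and `Q` are `F`-conjugate if some morphism from `P` to `Q` is a group isomorphism. -/
def IsConj (P Q : Subgroup S) : Prop := ∃ φ ∈ F.hom P Q, Function.Bijective φ

/-- The `F`-conjugacy class `[P]_F`. -/
def conjClass [Finite S] (P : Subgroup S) : Finset (Subgroup S) :=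
  (Set.toFinite {Q | F.IsConj P Q}).toFinset

/-- `P` is fully `F`-normalized. -/
def FullyNormalized (P : Subgroup S) : Prop :=
  ∀ Q, F.IsConj P Q →
    Nat.card (Subgroup.normalizer (Q : Set S)) ≤ Nat.card (Subgroup.normalizer (P : Set S))

/-- `P` is fully `F`-centralized. -/
def FullyCentralized (P : Subgroup S) : Prop :=
  ∀ Q, F.IsConj P Q →
    Nat.card (Subgroup.centralizer (Q : Set S)) ≤ Nat.card (Subgroup.centralizer (P : Set S))

/-- The group `Aut_F(P)`. -/
def aut (P : Subgroup S) : Subgroup (MulAut P) where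
  carrier := {α | α.toMonoidHom ∈ F.hom P P}
  one_mem' := by
    have e : conjHom P P 1 (by simp) = (1 : MulAut P).toMonoidHom := by
      ext x
      simp [conjHom]
    change (1 : MulAut P).toMonoidHom ∈ F.hom P P
    rw [← e]
    exact F.conj_mem P P 1 (by simp)
  mul_mem' {α β} hα hβ := F.comp_mem (φ := β.toMonoidHom) (ψ := α.toMonoidHom) hβ hα
  inv_mem' {α} hα := by
    have hle : ∀ x ∈ P, (1 : S) * x * 1⁻¹ ∈ homImage α.toMonoidHom := fun x hx =>
      ⟨α.symm ⟨x, hx⟩, by simp⟩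
    have h := F.comp_mem (F.conj_mem P _ 1 hle) (F.inv_mem (φ := α.toMonoidHom) hα)
    let m := MonoidHom.ofInjective (f := P.subtype.comp α.toMonoidHom)
      (P.subtype_injective.comp (F.injective hα))
    have e : m.symm.toMonoidHom.comp (conjHom P (homImage α.toMonoidHom) 1 hle) =
        (α⁻¹ : MulAut P).toMonoidHom := by
      refine MonoidHom.ext fun x => m.injective ((m.apply_symm_apply _).trans (Subtype.ext ?_))
      change (1 : S) * x * 1⁻¹ = ((α (α.symm x) : P) : S)
      simp
    change (α⁻¹ : MulAut P).toMonoidHom ∈ F.hom P P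
    rw [← e]
    exact h

/-- The group `Aut_S(P)` of automorphisms of `P` induced by conjugation in `S`. -/
def autS (P : Subgroup S) : Subgroup (MulAut P) := P.normalizerMonoidHom.range

/-- The subgroup `N_φ = {x ∈ N_S(P) | ∃ y ∈ S, φ ∘ c_x = c_y ∘ φ}`. The variable `h` below is the
element `c_x(g)` of `P`. -/
def extender {P Q : Subgroup S} (φ : P →* Q) : Subgroup S where
  carrier := {x | x ∈ Subgroup.normalizer (P : Set S) ∧
    ∃ y : S, ∀ g h : P, (h : S) = x * g * x⁻¹ → (φ h : S) = y * φ g * y⁻¹}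
  one_mem' := ⟨one_mem _, 1, fun g h e => by
    have : h = g := Subtype.ext (by simpa using e)
    simp [this]⟩
  mul_mem' := by
    rintro a b ⟨ha, y, hy⟩ ⟨hb, z, hz⟩
    refine ⟨mul_mem ha hb, y * z, fun g h e => ?_⟩
    have hk : b * (g : S) * b⁻¹ ∈ P := (Subgroup.mem_normalizer_iff.1 hb _).1 g.2
    rw [hy ⟨_, hk⟩ h (by rw [e]; group), hz g ⟨_, hk⟩ rfl]
    group
  inv_mem' := by
    rintro a ⟨ha, y, hy⟩
    refine ⟨Subgroup.inv_mem _ ha, y⁻¹, fun g h e => ?_⟩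
    rw [hy h g (by rw [e]; group)]
    group

theorem le_extender {P Q : Subgroup S} (φ : P →* Q) : P ≤ extender φ := by
  intro x hx
  refine ⟨Subgroup.le_normalizer hx, φ ⟨x, hx⟩, fun g h e => ?_⟩
  have : h = ⟨x, hx⟩ * g * ⟨x, hx⟩⁻¹ := Subtype.ext (by simpa using e)
  simp [this]

/-- A fusion system on a `p`-group `S` is saturated if every fully normalized subgroup `P` is fully
centralized with `Aut_S(P)` a Sylow `p`-subgroup of `Aut_F(P)`, and every morphism `φ : P → S` with
fully centralized image extends to a morphism `N_φ → S`. -/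
structure IsSaturated (p : ℕ) : Prop where
  fullyCentralized : ∀ P, F.FullyNormalized P → F.FullyCentralized P
  sylow : ∀ P, F.FullyNormalized P →
    ∃ T : Sylow p (F.aut P), (T : Subgroup (F.aut P)) = (autS P).subgroupOf (F.aut P)
  extend : ∀ (P : Subgroup S), ∀ φ ∈ F.hom P ⊤, F.FullyCentralized (homImage φ) →
    ∃ ψ ∈ F.hom (extender φ) ⊤, ψ.comp (Subgroup.inclusion (le_extender φ)) = φ

/-- The Burnside ring `A(F)`: the subring of `F`-stable elements of `A(S)`, those whose restriction
along every morphism `φ : P → S` of `F` equals the restriction along the inclusion. -/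
def burnside : Subring (BurnsideRing S) where
  carrier := {X | ∀ (P : Subgroup S), ∀ φ ∈ F.hom P ⊤,
    BurnsideRing.res ((⊤ : Subgroup S).subtype.comp φ) X = BurnsideRing.res P.subtype X}
  one_mem' P φ _ := by simp only [map_one]
  zero_mem' P φ _ := by simp only [map_zero]
  mul_mem' hX hY P φ hφ := by simp only [map_mul, hX P φ hφ, hY P φ hφ]
  add_mem' hX hY P φ hφ := by simp only [map_add, hX P φ hφ, hY P φ hφ]
  neg_mem' hX P φ hφ := by simp only [map_neg, hX P φ hφ]

/-- The `p`-localized Burnside ring `A(F)_(p)` as a subring of `A(S)_(p)`: the image of the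
(injective) map `A(F)_(p) → A(S)_(p)` induced by the inclusion `A(F) ⊆ A(S)`. -/
def pBurnside (p : ℕ) [Fact p.Prime] : Subring (PLocal p (BurnsideRing S)) :=
  (PLocal.map p F.burnside.subtype).range

end FusionSystem

end

/-!
Let `P` be fully normalized. The group `S × N_S(P)` acts on the morphisms `P → S`, and by the
extension property the orbits of those that do not extend to `N_S(P)` have size divisible by
`p |S : C_S(P)|`. Induction over normalizers thus shows that the number of morphisms `P → S` has the
same `p`-part as `|S : C_S(P)|`, and dividing by `|Aut_F(P)|` gives `|[P]_F| = k |S : N_S(P)|` with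
`k` prime to `p`.

If `X` is stable at all subgroups larger than `P`, then `|P| (Φ_Q(X) - Φ_P(X))` is divisible by
`|N_S(Q)|` for `Q ∈ [P]_F`, by Burnside's lemma on `N_S(Q)`. Summing these congruences over `[P]_F`
shows that `k X` becomes stable at `P` after adding a combination of the `S/Q`, `Q ∈ [P]_F`, whose
marks at `[P]_F` sum to zero. All `S/Q` with `Q ∈ [P]_F` have the same sums of marks over conjugacy
classes, so this combination has all such sums equal to zero and leaves the averages of marks
unchanged. Descending through the subgroups, one reaches an `F`-stable element whose marks are, up
to a factor prime to `p`, the averages of the marks of `X`.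
-/

/-! ### Marks separate the elements of a Burnside ring -/

namespace FinGSet

variable {G : Type u} [Group G]

/-- The transitive `G`-set `G ⧸ P`. -/
noncomputable def coset (P : Subgroup G) [P.FiniteIndex] : FinGSet G := ⟨G ⧸ P⟩

instance finiteIndex_stabilizer (X : FinGSet G) (x : X.carrier) :
    (MulAction.stabilizer G x).FiniteIndex :=
  Subgroup.finiteIndex_iff_finite_quotient.2 <|
    Finite.of_equiv _ (MulAction.orbitEquivQuotientStabilizer G x)

/-- The complement of the orbit of `x`, as a `G`-set. -/
def removeOrbit (X : FinGSet G) (x : X.carrier) : FinGSet G :=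
  ⟨((⟨MulAction.orbit G x, fun g _ => MulAction.mem_orbit_of_mem_orbit g⟩ :
    SubMulAction G X.carrier)ᶜ : SubMulAction G X.carrier)⟩

theorem card_removeOrbit_lt (X : FinGSet G) (x : X.carrier) :
    Nat.card (X.removeOrbit x).carrier < Nat.card X.carrier :=
  Finite.card_subtype_lt (x := x) fun h => h (MulAction.mem_orbit_self x)

theorem isIso_sum_removeOrbit (X : FinGSet G) (x : X.carrier) :
    IsIso ((coset (MulAction.stabilizer G x)).sum (X.removeOrbit x)) X := by
  classical
  refine ⟨(Equiv.sumCongr (MulAction.orbitEquivQuotientStabilizer G x).symm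
    (Equiv.refl _)).trans (Equiv.Set.sumCompl (MulAction.orbit G x)), ?_⟩
  rintro g (y | y)
  · induction y using Quotient.inductionOn with
    | h a => exact mul_smul g a x
  · rfl

end FinGSet

theorem mem_fixedPoints_iff_le_stabilizer {G X : Type*} [Group G] [MulAction G X]
    {P : Subgroup G} {x : X} :
    x ∈ MulAction.fixedPoints P X ↔ P ≤ MulAction.stabilizer G x :=
  ⟨fun h g hg => h ⟨g, hg⟩, fun h g => h g.2⟩

namespace FinGSetClass

variable {G : Type u} [Group G]

/-- The isomorphism class of a finite `G`-set. -/
abbrev mk (X : FinGSet G) : FinGSetClass G := Quotient.mk _ X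

theorem mk_eq_coset_add (X : FinGSet G) (x : X.carrier) :
    mk X = mk (.coset (MulAction.stabilizer G x)) + mk (X.removeOrbit x) :=
  (Quotient.sound (X.isIso_sum_removeOrbit x)).symm

theorem mark_mk (P : Subgroup G) (X : FinGSet G) :
    mark P (mk X) = Nat.card (MulAction.fixedPoints P X.carrier) := rfl

theorem mark_ne_zero_iff {P : Subgroup G} {X : FinGSet G} :
    mark P (mk X) ≠ 0 ↔ ∃ x : X.carrier, P ≤ MulAction.stabilizer G x := by
  have : Finite (MulAction.fixedPoints P X.carrier) := Subtype.finite
  simp only [mark_mk, Nat.card_ne_zero, this, and_true, nonempty_subtype,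
    mem_fixedPoints_iff_le_stabilizer]

theorem exists_stabilizer_eq {X Y : FinGSet G} [Nonempty X.carrier]
    (h : ∀ P, mark P (mk X) = mark P (mk Y)) :
    ∃ (x : X.carrier) (y : Y.carrier),
      MulAction.stabilizer G x = MulAction.stabilizer G y := by
  obtain ⟨x, -, hx⟩ := Set.finite_univ.exists_maximalFor
    (fun x : X.carrier => MulAction.stabilizer G x) _ Set.univ_nonempty
  obtain ⟨y, hxy⟩ := mark_ne_zero_iff.1 (h (MulAction.stabilizer G x) ▸
    mark_ne_zero_iff.2 ⟨x, le_rfl⟩)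
  obtain ⟨x', hyx'⟩ := mark_ne_zero_iff.1 ((h (MulAction.stabilizer G y)).symm ▸
    mark_ne_zero_iff.2 ⟨y, le_rfl⟩)
  exact ⟨x, y, hxy.antisymm (hyx'.trans (hx (Set.mem_univ x') (hxy.trans hyx')))⟩

theorem mk_eq_mk_of_mark_eq {X Y : FinGSet G} (h : ∀ P, mark P (mk X) = mark P (mk Y)) :
    mk X = mk Y := by
  induction hn : Nat.card X.carrier using Nat.strong_induction_on generalizing X Y with
  | _ n ih =>
  obtain hX | hX := isEmpty_or_nonempty X.carrier
  · have hY : IsEmpty Y.carrier := by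
      by_contra! ⟨y⟩
      obtain ⟨x, -⟩ := mark_ne_zero_iff.1 (h ⊥ ▸ mark_ne_zero_iff.2 ⟨y, bot_le⟩)
      exact hX.elim x
    exact Quotient.sound ⟨Equiv.equivOfIsEmpty _ _, fun _ x => hX.elim x⟩
  · obtain ⟨x, y, hxy⟩ := exists_stabilizer_eq h
    have hX := mk_eq_coset_add X x
    have hY : mk Y = mk (.coset (MulAction.stabilizer G x)) + mk (Y.removeOrbit y) := by
      simpa only [hxy] using mk_eq_coset_add Y y
    have hremove : mk (X.removeOrbit x) = mk (Y.removeOrbit y) := by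
      refine ih _ (hn ▸ X.card_removeOrbit_lt x) (fun P => ?_) rfl
      have hP := h P
      rw [hX, hY, map_add, map_add] at hP
      exact Nat.add_left_cancel hP
    rw [hX, hY, hremove]

theorem ext_mark {x y : FinGSetClass G} (h : ∀ P, mark P x = mark P y) : x = y := by
  induction x, y using Quotient.inductionOn₂ with
  | h X Y => exact mk_eq_mk_of_mark_eq h

theorem mark_sup_zpowers (P : Subgroup G) [P.Normal] (g : G) (X : FinGSet G) :
    mark (P ⊔ Subgroup.zpowers g) (mk X) =
      Nat.card (MulAction.fixedBy (MulAction.fixedPoints P X.carrier) g) := by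
  have hfix : ∀ x : X.carrier, x ∈ MulAction.fixedPoints (P ⊔ Subgroup.zpowers g :) X.carrier ↔
      x ∈ MulAction.fixedPoints P X.carrier ∧ g • x = x := fun x => by
    simp only [mem_fixedPoints_iff_le_stabilizer, sup_le_iff, Subgroup.zpowers_le,
      MulAction.mem_stabilizer_iff]
  refine Nat.card_congr ((Equiv.subtypeEquivRight hfix).trans
    ((Equiv.subtypeSubtypeEquivSubtypeInter _ _).symm.trans
      (Equiv.subtypeEquivRight fun _ => ?_)))
  rw [MulAction.mem_fixedBy, Subtype.ext_iff]
  rfl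

theorem card_dvd_sum_mark [Fintype G] (P : Subgroup G) [P.Normal] (x : FinGSetClass G) :
    Nat.card G ∣ ∑ g : G, mark (P ⊔ Subgroup.zpowers g) x := by
  induction x using Quotient.inductionOn with
  | h X =>
  have hburnside := Nat.card_congr
    (MulAction.sigmaFixedByEquivOrbitsProdGroup G (MulAction.fixedPoints P X.carrier))
  rw [Nat.card_sigma, Nat.card_prod] at hburnside
  simp only [mark_sup_zpowers, hburnside]
  exact dvd_mul_left _ _

theorem mark_res {H : Type u} [Group H] (f : H →* G) (P : Subgroup H) (x : FinGSetClass G) :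
    mark P (res f x) = mark (P.map f) x := by
  induction x using Quotient.inductionOn with
  | h X =>
  refine Nat.card_congr (Equiv.subtypeEquivRight fun x => ⟨?_, fun h n => ?_⟩)
  · rintro h ⟨_, n, hn, rfl⟩
    exact h ⟨n, hn⟩
  · exact h ⟨f n, n, n.2, rfl⟩

end FinGSetClass

namespace BurnsideRing

variable {G : Type u} [Group G]

theorem mark_of (P : Subgroup G) (x : FinGSetClass G) :
    mark P (GrothendieckRing.of x) = (FinGSetClass.mark P x : ℤ) :=
  GrothendieckRing.lift_of _ x

theorem res_of {H : Type u} [Group H] (f : H →* G) (x : FinGSetClass G) :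
    res f (GrothendieckRing.of x) = GrothendieckRing.of (FinGSetClass.res f x) :=
  GrothendieckRing.lift_of _ x

theorem exists_of_sub_of (X : BurnsideRing G) :
    ∃ a b : FinGSetClass G, X = GrothendieckRing.of a - GrothendieckRing.of b :=
  GrothendieckRing.exists_sub X

theorem ext_mark {X Y : BurnsideRing G} (h : ∀ P, mark P X = mark P Y) : X = Y := by
  obtain ⟨a, b, hab⟩ := exists_of_sub_of (X - Y)
  have hmark : ∀ P, FinGSetClass.mark P a = FinGSetClass.mark P b := fun P => by
    have hP := congrArg (mark P) hab
    rw [map_sub, h, sub_self, map_sub, mark_of, mark_of, eq_comm, sub_eq_zero] at hP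
    exact_mod_cast hP
  rw [← sub_eq_zero, hab, FinGSetClass.ext_mark hmark, sub_self]

theorem mark_res {H : Type u} [Group H] (f : H →* G) (P : Subgroup H) (X : BurnsideRing G) :
    mark P (res f X) = mark (P.map f) X := by
  obtain ⟨a, b, rfl⟩ := exists_of_sub_of X
  simp only [map_sub, res_of, mark_of, FinGSetClass.mark_res]

theorem card_dvd_sum_mark [Fintype G] (P : Subgroup G) [P.Normal] (X : BurnsideRing G) :
    (Nat.card G : ℤ) ∣ ∑ g : G, mark (P ⊔ Subgroup.zpowers g) X := by
  obtain ⟨a, b, rfl⟩ := exists_of_sub_of X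
  simp only [map_sub, mark_of, Finset.sum_sub_distrib]
  exact dvd_sub (mod_cast FinGSetClass.card_dvd_sum_mark P a)
    (mod_cast FinGSetClass.card_dvd_sum_mark P b)

theorem card_dvd_card_mul_mark [Finite G] (P : Subgroup G) [P.Normal] {X : BurnsideRing G}
    (h : ∀ Q, P < Q → mark Q X = 0) : (Nat.card G : ℤ) ∣ Nat.card P * mark P X := by
  classical
  have := Fintype.ofFinite G
  have hterm : ∀ g : G, mark (P ⊔ Subgroup.zpowers g) X = if g ∈ P then mark P X else 0 := by
    intro g
    split_ifs with hg
    · rw [sup_eq_left.2 (Subgroup.zpowers_le.2 hg)]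
    · exact h _ (left_lt_sup.2 fun hle => hg (Subgroup.zpowers_le.1 hle))
  have hsum : ∑ g : G, mark (P ⊔ Subgroup.zpowers g) X = Nat.card P * mark P X := by
    simp only [hterm]
    rw [← Finset.sum_filter, Finset.sum_const, nsmul_eq_mul, ← Fintype.card_subtype,
      ← Nat.card_eq_fintype_card]
  exact hsum ▸ card_dvd_sum_mark P X

end BurnsideRing

/-! ### The `p`-localization -/

namespace PLocal

variable (p : ℕ) [Fact p.Prime] {A : Type*} [CommRing A]

theorem exists_intCast_mul_eq_algebraMap (X : PLocal p A) :
    ∃ (n : ℤ) (Y : A), ¬ (p : ℤ) ∣ n ∧ (n : PLocal p A) * X = algebraMap _ _ Y := by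
  obtain ⟨⟨Y, ⟨_, n, hn, rfl⟩⟩, h⟩ :=
    IsLocalization.surj (Algebra.algebraMapSubmonoid A (primeToP p)) X
  exact ⟨n, Y, hn, by simpa [mul_comm] using h⟩

theorem map_algebraMap {B : Type*} [CommRing B] (f : A →+* B) (a : A) :
    PLocal.map p f (algebraMap _ _ a) = algebraMap _ _ (f a) :=
  IsLocalization.map_eq _ _

theorem isUnit_intCast {n : ℤ} (hn : ¬ (p : ℤ) ∣ n) : IsUnit (n : PLocal p A) := by
  simpa using IsLocalization.map_units (PLocal p A)
    (⟨algebraMap ℤ A n, n, hn, rfl⟩ : Algebra.algebraMapSubmonoid A (primeToP p))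

end PLocal

namespace BurnsideRing

variable {G : Type u} [Group G] (p : ℕ) [Fact p.Prime]

theorem pMark_algebraMap (P : Subgroup G) (X : BurnsideRing G) :
    pMark p P (algebraMap _ _ X) = (mark P X : ℚ) := by
  simp [pMark]

theorem ext_pMark {X Y : PLocal p (BurnsideRing G)} (h : ∀ P, pMark p P X = pMark p P Y) :
    X = Y := by
  obtain ⟨n, Z, hn, hZ⟩ := PLocal.exists_intCast_mul_eq_algebraMap p (X - Y)
  have hZ_zero : Z = 0 := ext_mark fun P => by
    have hP := congrArg (pMark p P) hZ
    rw [map_mul, map_sub, h, sub_self, mul_zero, pMark_algebraMap] at hP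
    rw [map_zero]
    exact_mod_cast hP.symm
  rw [hZ_zero, map_zero] at hZ
  exact sub_eq_zero.1 ((PLocal.isUnit_intCast p hn).mul_right_eq_zero.1 hZ)

end BurnsideRing

/-! ### Morphisms of a fusion system -/

namespace FusionSystem

variable {S : Type u} [Group S] (F : FusionSystem S) {P Q R : Subgroup S}

/-- A homomorphism `P → S` with target the subgroup `⊤` of `S`, as in `F.hom P ⊤`. -/
abbrev toTop (φ : P →* S) : P →* (⊤ : Subgroup S) := φ.codRestrict ⊤ fun _ => trivial

/-- `φ : P → S` is a morphism of `F`. -/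
def IsMor (φ : P →* S) : Prop := toTop φ ∈ F.hom P ⊤

variable {F}

theorem inclusion_mem_hom (h : P ≤ Q) : Subgroup.inclusion h ∈ F.hom P Q := by
  have hle : ∀ x ∈ P, 1 * x * 1⁻¹ ∈ Q := fun x hx => by simpa using h hx
  convert F.conj_mem P Q 1 hle using 1
  ext x
  simp [conjHom]

theorem isMor_of_mem_hom {φ : P →* Q} (h : φ ∈ F.hom P Q) : F.IsMor (Q.subtype.comp φ) :=
  F.comp_mem h (inclusion_mem_hom le_top)

theorem isMor_subtype (P : Subgroup S) : F.IsMor P.subtype := inclusion_mem_hom le_top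

namespace IsMor

variable {φ : P →* S} {ψ : Q →* S}

theorem injective (h : F.IsMor φ) : Function.Injective φ := fun _ _ e =>
  F.injective h (Subtype.ext e)

theorem comp (hψ : F.IsMor ψ) {χ : P →* Q} (hχ : χ ∈ F.hom P Q) : F.IsMor (ψ.comp χ) :=
  F.comp_mem hχ hψ

theorem conj_comp (h : F.IsMor φ) (s : S) : F.IsMor ((MulAut.conj s).toMonoidHom.comp φ) :=
  F.comp_mem h (F.conj_mem ⊤ ⊤ s fun _ _ => trivial)

theorem ofInjective_mem_hom (h : F.IsMor φ) :
    (MonoidHom.ofInjective h.injective).toMonoidHom ∈ F.hom P φ.range :=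
  F.toImage_mem h

theorem ofInjective_symm_mem_hom (h : F.IsMor φ) :
    (MonoidHom.ofInjective h.injective).symm.toMonoidHom ∈ F.hom φ.range P :=
  F.inv_mem h

theorem congr_mem_aut (h : F.IsMor φ) {α : MulAut P} (hα : α ∈ F.aut P) :
    MulAut.congr (MonoidHom.ofInjective h.injective) α ∈ F.aut φ.range :=
  F.comp_mem (F.comp_mem h.ofInjective_symm_mem_hom hα) h.ofInjective_mem_hom

theorem exists_comp_eq_of_range_eq {φ ψ : P →* S} (hφ : F.IsMor φ) (hψ : F.IsMor ψ)
    (h : φ.range = ψ.range) : ∃ α ∈ F.aut P, ψ.comp α.toMonoidHom = φ := by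
  let α : MulAut P := (MonoidHom.ofInjective hφ.injective).trans
    ((MulEquiv.subgroupCongr h).trans (MonoidHom.ofInjective hψ.injective).symm)
  refine ⟨α, F.comp_mem hφ.ofInjective_mem_hom
    (F.comp_mem (inclusion_mem_hom h.le) hψ.ofInjective_symm_mem_hom), MonoidHom.ext fun x => ?_⟩
  exact congrArg Subtype.val ((MonoidHom.ofInjective hψ.injective).apply_symm_apply
    (MulEquiv.subgroupCongr h (MonoidHom.ofInjective hφ.injective x)))

end IsMor

/-! ### Conjugacy of subgroups -/

theorem isConj_iff_exists_isMor : F.IsConj P Q ↔ ∃ φ : P →* S, F.IsMor φ ∧ φ.range = Q := by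
  constructor
  · rintro ⟨φ, hφ, hbij⟩
    refine ⟨Q.subtype.comp φ, isMor_of_mem_hom hφ, ?_⟩
    rw [MonoidHom.range_comp, MonoidHom.range_eq_top.2 hbij.2, ← MonoidHom.range_eq_map,
      Subgroup.range_subtype]
  · rintro ⟨φ, hφ, rfl⟩
    exact ⟨_, hφ.ofInjective_mem_hom, (MonoidHom.ofInjective hφ.injective).bijective⟩

theorem IsMor.isConj {φ : P →* S} (h : F.IsMor φ) : F.IsConj P φ.range :=
  isConj_iff_exists_isMor.2 ⟨φ, h, rfl⟩

theorem IsMor.isConj_map {φ : P →* S} (h : F.IsMor φ) (hQ : Q ≤ P) :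
    F.IsConj Q ((Q.subgroupOf P).map φ) := by
  simpa only [MonoidHom.range_comp, Subgroup.inclusion_range] using
    (h.comp (inclusion_mem_hom hQ)).isConj

namespace IsConj

theorem refl (P : Subgroup S) : F.IsConj P P :=
  isConj_iff_exists_isMor.2 ⟨_, isMor_subtype P, P.range_subtype⟩

theorem symm (h : F.IsConj P Q) : F.IsConj Q P := by
  obtain ⟨φ, hφ, rfl⟩ := isConj_iff_exists_isMor.1 h
  exact ⟨_, hφ.ofInjective_symm_mem_hom, (MonoidHom.ofInjective hφ.injective).symm.bijective⟩

theorem trans (h : F.IsConj P Q) (h' : F.IsConj Q R) : F.IsConj P R := by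
  obtain ⟨φ, hφ, hbij⟩ := h
  obtain ⟨ψ, hψ, hbij'⟩ := h'
  exact ⟨_, F.comp_mem hφ hψ, hbij'.comp hbij⟩

theorem card_eq (h : F.IsConj P Q) : Nat.card P = Nat.card Q := by
  obtain ⟨φ, -, hbij⟩ := h
  exact Nat.card_congr (Equiv.ofBijective φ hbij)

end IsConj

theorem isConj_map_conj (P : Subgroup S) (s : S) :
    F.IsConj P (P.map (MulAut.conj s).toMonoidHom) := by
  simpa only [MonoidHom.range_comp, Subgroup.range_subtype] using
    ((isMor_subtype P).conj_comp s).isConj (F := F)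

section Finite

variable [Finite S]

theorem mem_conjClass : Q ∈ F.conjClass P ↔ F.IsConj P Q := by
  simp [conjClass]

theorem self_mem_conjClass (P : Subgroup S) : P ∈ F.conjClass P := mem_conjClass.2 (.refl P)

theorem card_conjClass_pos (P : Subgroup S) : 0 < (F.conjClass P).card :=
  Finset.card_pos.2 ⟨P, self_mem_conjClass P⟩

theorem conjClass_top : F.conjClass ⊤ = {⊤} := by
  ext Q
  rw [mem_conjClass, Finset.mem_singleton]
  constructor
  · exact fun h => Subgroup.eq_top_of_card_eq _ (by rw [← h.card_eq, Subgroup.card_top])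
  · rintro rfl
    exact .refl _

variable (F) in
theorem exists_fullyNormalized (P : Subgroup S) :
    ∃ Q, F.IsConj P Q ∧ F.FullyNormalized Q := by
  obtain ⟨Q, hQ, hmax⟩ := (F.conjClass P).exists_max_image
    (fun Q => Nat.card (Subgroup.normalizer (Q : Set S))) ⟨P, self_mem_conjClass P⟩
  rw [mem_conjClass] at hQ
  exact ⟨Q, hQ, fun R hR => hmax R (mem_conjClass.2 (hQ.trans hR))⟩

end Finite

theorem FullyCentralized.card_eq (hP : F.FullyCentralized P) (hQ : F.FullyCentralized Q)
    (h : F.IsConj P Q) : Nat.card (Subgroup.centralizer (P : Set S)) =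
      Nat.card (Subgroup.centralizer (Q : Set S)) :=
  le_antisymm (hQ _ h.symm) (hP _ h)

theorem FullyCentralized.of_isConj (hP : F.FullyCentralized P) (h : F.IsConj P Q)
    (hcard : Nat.card (Subgroup.centralizer (P : Set S)) ≤
      Nat.card (Subgroup.centralizer (Q : Set S))) : F.FullyCentralized Q :=
  fun _ hR => (hP _ (h.trans hR)).trans hcard

theorem FullyNormalized.of_isConj (hP : F.FullyNormalized P) (h : F.IsConj P Q)
    (hcard : Nat.card (Subgroup.normalizer (P : Set S)) ≤
      Nat.card (Subgroup.normalizer (Q : Set S))) : F.FullyNormalized Q :=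
  fun _ hR => (hP _ (h.trans hR)).trans hcard

end FusionSystem

/-! ### Consequences of saturation -/

theorem range_subtype_comp_mulEquiv {G G' : Type*} [Group G] [Group G'] {P : Subgroup G}
    (γ : G' ≃* P) : (P.subtype.comp γ.toMonoidHom).range = P := by
  rw [MonoidHom.range_comp, MonoidHom.range_eq_top.2 γ.surjective, ← MonoidHom.range_eq_map,
    Subgroup.range_subtype]

theorem card_map_normalizerMonoidHom_mul {G : Type*} [Group G] {T H : Subgroup G}
    (hC : Subgroup.centralizer (T : Set G) ≤ H) (hN : H ≤ Subgroup.normalizer (T : Set G)) :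
    Nat.card ((H.subgroupOf (Subgroup.normalizer (T : Set G))).map T.normalizerMonoidHom) *
      Nat.card (Subgroup.centralizer (T : Set G)) = Nat.card H := by
  rw [← Subgroup.relIndex_ker, Subgroup.normalizerMonoidHom_ker,
    Subgroup.relIndex_subgroupOf hN, mul_comm, ← Subgroup.relIndex_bot_left,
    Subgroup.relIndex_mul_relIndex _ _ _ bot_le hC, Subgroup.relIndex_bot_left]

theorem range_le_normalizer_map {G G' : Type*} [Group G] [Group G'] {P T : Subgroup G}
    (hT : T ≤ Subgroup.normalizer (P : Set G)) (ψ : T →* G') :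
    ψ.range ≤ Subgroup.normalizer (((P.subgroupOf T).map ψ : Subgroup G') : Set G') := by
  have hnormal := Subgroup.normal_subgroupOf_of_le_normalizer hT
  rw [MonoidHom.range_eq_map, ← Subgroup.normalizer_eq_top_iff.2 hnormal]
  exact Subgroup.le_normalizer_map ψ

namespace FusionSystem

open scoped Pointwise

variable {S : Type u} [Group S] {F : FusionSystem S} {P Q T : Subgroup S} {p : ℕ}

theorem mem_extender_toTop_iff {φ : P →* S} (t : Subgroup.normalizer (P : Set S)) :
    (t : S) ∈ extender (toTop φ) ↔
      ∃ y : S, ∀ x : P, φ (P.normalizerMonoidHom t x) = y * φ x * y⁻¹ := by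
  constructor
  · rintro ⟨-, y, hy⟩
    exact ⟨y, fun x => hy x _ rfl⟩
  · rintro ⟨y, hy⟩
    refine ⟨t.2, y, fun g h hgh => ?_⟩
    obtain rfl : h = P.normalizerMonoidHom t g := Subtype.ext hgh
    exact hy g

theorem IsSaturated.exists_extension (hF : F.IsSaturated p) {φ : P →* S} (hφ : F.IsMor φ)
    (hc : F.FullyCentralized φ.range) (hPT : P ≤ T) (hT : T ≤ extender (toTop φ)) :
    ∃ ψ : T →* S, F.IsMor ψ ∧ ψ.comp (Subgroup.inclusion hPT) = φ := by
  obtain ⟨ψ, hψ, hext⟩ := hF.extend P _ hφ hc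
  refine ⟨_, (isMor_of_mem_hom hψ).comp (inclusion_mem_hom hT), MonoidHom.ext fun x => ?_⟩
  exact congrArg Subtype.val (DFunLike.congr_fun hext x)

theorem autS_le_aut (P : Subgroup S) : autS P ≤ F.aut P := by
  rintro _ ⟨s, rfl⟩
  exact F.conj_mem P P s fun x hx => (Subgroup.mem_normalizer_iff.1 s.2 x).1 hx

theorem isPGroup_autS (hS : IsPGroup p S) (P : Subgroup S) : IsPGroup p (autS P) :=
  (hS.to_subgroup _).of_surjective _ P.normalizerMonoidHom.rangeRestrict_surjective

theorem IsSaturated.exists_conj_le_autS [Fact p.Prime] [Finite S] (hF : F.IsSaturated p)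
    (hP : F.FullyNormalized P) {K : Subgroup (MulAut P)} (hK : K ≤ F.aut P)
    (hpK : IsPGroup p K) : ∃ β ∈ F.aut P, MulAut.conj β • K ≤ autS P := by
  obtain ⟨T, hT⟩ := hF.sylow P hP
  obtain ⟨U, hU⟩ := (hpK.comap_of_injective (F.aut P).subtype
    (F.aut P).subtype_injective).exists_le_sylow
  obtain ⟨b, hb⟩ := MulAction.exists_smul_eq (F.aut P) U T
  refine ⟨b, b.2, ?_⟩
  rintro _ ⟨κ, hκ, rfl⟩
  have hmem : MulAut.conj b ⟨κ, hK hκ⟩ ∈ (T : Subgroup (F.aut P)) := by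
    rw [← hb]
    exact Subgroup.smul_mem_pointwise_smul _ (MulAut.conj b) _ (hU hκ)
  rw [hT] at hmem
  exact hmem

theorem IsSaturated.exists_isMor_normalizer_map_eq [Fact p.Prime] [Finite S] (hS : IsPGroup p S)
    (hF : F.IsSaturated p) (hP : F.FullyNormalized P) (hQ : F.IsConj Q P) :
    ∃ φ : Subgroup.normalizer (Q : Set S) →* S, F.IsMor φ ∧
      (Q.subgroupOf (Subgroup.normalizer (Q : Set S))).map φ = P := by
  obtain ⟨χ, hχ, rfl⟩ := isConj_iff_exists_isMor.1 hQ
  let e := MonoidHom.ofInjective hχ.injective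
  obtain ⟨β, hβ, hconj⟩ := hF.exists_conj_le_autS hP
    (K := (autS Q).map (MulAut.congr e).toMonoidHom) (by
      rintro _ ⟨α, hα, rfl⟩
      exact hχ.congr_mem_aut (autS_le_aut Q hα)) ((isPGroup_autS hS Q).map _)
  let γ : Q ≃* χ.range := e.trans β
  let φ : Q →* S := χ.range.subtype.comp γ.toMonoidHom
  have hφ : F.IsMor φ := isMor_of_mem_hom (F.comp_mem hχ.ofInjective_mem_hom hβ)
  have hrange : φ.range = χ.range := range_subtype_comp_mulEquiv γ
  have hextender : Subgroup.normalizer (Q : Set S) ≤ extender (toTop φ) := by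
    intro t ht
    obtain ⟨y, hy⟩ := hconj (Subgroup.smul_mem_pointwise_smul _ (MulAut.conj β) _
      (Subgroup.mem_map_of_mem _ ⟨⟨t, ht⟩, rfl⟩))
    refine (mem_extender_toTop_iff ⟨t, ht⟩).2 ⟨y, fun x => ?_⟩
    have hx : γ (Q.normalizerMonoidHom ⟨t, ht⟩ x) = χ.range.normalizerMonoidHom y (γ x) := by
      simpa [γ] using (DFunLike.congr_fun hy (γ x)).symm
    exact congrArg Subtype.val hx
  obtain ⟨ψ, hψ, hext⟩ := hF.exists_extension hφ (hrange ▸ hF.fullyCentralized _ hP)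
    Subgroup.le_normalizer hextender
  refine ⟨ψ, hψ, ?_⟩
  rw [← Subgroup.inclusion_range Subgroup.le_normalizer, ← MonoidHom.range_comp, hext, hrange]

theorem IsSaturated.exists_padicValNat_card_autS_inf [Fact p.Prime] [Finite S]
    (hF : F.IsSaturated p) (hT : F.FullyNormalized T) {L : Subgroup (MulAut T)}
    (hL : L ≤ F.aut T) : ∃ β ∈ F.aut T,
      padicValNat p (Nat.card (autS T ⊓ MulAut.conj β • L : Subgroup (MulAut T))) =
        padicValNat p (Nat.card L) := by
  let U : Sylow p L := default
  obtain ⟨β, hβ, hconj⟩ := hF.exists_conj_le_autS hT ((Subgroup.map_subtype_le U.1).trans hL)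
    (U.2.map L.subtype)
  refine ⟨β, hβ, le_antisymm ?_ ?_⟩
  · rw [Nat.card_congr (Subgroup.equivSMul (MulAut.conj β) L).toEquiv]
    exact (padicValNat_dvd_iff_le Nat.card_pos.ne').1
      (pow_padicValNat_dvd.trans (Subgroup.card_dvd_of_le inf_le_right))
  · have hU : Nat.card (MulAut.conj β • U.1.map L.subtype : Subgroup (MulAut T)) =
        p ^ padicValNat p (Nat.card L) := by
      rw [← Nat.card_congr (Subgroup.equivSMul (MulAut.conj β) _).toEquiv,
        Subgroup.card_map_of_injective L.subtype_injective, U.card_eq_multiplicity,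
        Nat.factorization_def _ Fact.out]
    rw [← padicValNat_dvd_iff_le Nat.card_pos.ne', ← hU]
    exact Subgroup.card_dvd_of_le (le_inf hconj
      (Subgroup.pointwise_smul_le_pointwise_smul_iff.2 (Subgroup.map_subtype_le U.1)))

/-! ### Normalizers of fully normalized subgroups -/

theorem FullyNormalized.normalizer_map [Finite S] (hP : F.FullyNormalized P)
    {ψ : Subgroup.normalizer (P : Set S) →* S} (hψ : F.IsMor ψ) :
    Subgroup.normalizer (((P.subgroupOf (Subgroup.normalizer (P : Set S))).map ψ : Subgroup S) :
      Set S) = ψ.range := by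
  refine (Subgroup.eq_of_le_of_card_ge (range_le_normalizer_map le_rfl ψ) ?_).symm
  exact (hP _ (hψ.isConj_map Subgroup.le_normalizer)).trans hψ.isConj.card_eq.le

theorem FullyNormalized.map [Finite S] (hP : F.FullyNormalized P)
    {ψ : Subgroup.normalizer (P : Set S) →* S} (hψ : F.IsMor ψ) :
    F.FullyNormalized ((P.subgroupOf (Subgroup.normalizer (P : Set S))).map ψ) := by
  refine hP.of_isConj (hψ.isConj_map Subgroup.le_normalizer) ?_
  rw [hP.normalizer_map hψ]
  exact hψ.isConj.card_eq.le

variable (F) in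
/-- The automorphisms of `T` in `F` that are the identity on the subgroup `L` of `T`. -/
noncomputable def autFixing (L : Subgroup T) : Subgroup (MulAut T) :=
  F.aut T ⊓ fixingSubgroup (MulAut T) (L : Set T)

theorem conj_smul_autFixing {β : MulAut T} (hβ : β ∈ F.aut T) (L : Subgroup T) :
    MulAut.conj β • F.autFixing L = F.autFixing (L.map β.toMonoidHom) := by
  rw [autFixing, Subgroup.smul_inf, Subgroup.conj_smul_eq_self_of_mem hβ]
  exact congrArg (F.aut T ⊓ ·)
    (SubMulAction.fixingSubgroup_smul_eq_fixingSubgroup_map_conj (L : Set T) β).symm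

theorem autS_inf_fixingSubgroup (L : Subgroup T) :
    autS T ⊓ fixingSubgroup (MulAut T) (L : Set T) =
      ((Subgroup.centralizer (L.map T.subtype : Set S)).subgroupOf
        (Subgroup.normalizer (T : Set S))).map T.normalizerMonoidHom := by
  rw [autS, ← Subgroup.map_comap_eq]
  congr 1
  ext t
  simp only [Subgroup.mem_comap, mem_fixingSubgroup_iff, SetLike.mem_coe, MulAut.smul_def,
    Subtype.ext_iff, Subgroup.normalizerMonoidHom_apply_apply_coe, mul_inv_eq_iff_eq_mul,
    Subtype.forall, Subgroup.coe_map, Subgroup.subtype_apply, Subgroup.coe_subtype,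
    Subgroup.mem_subgroupOf, Subgroup.mem_centralizer_iff, Set.mem_image, Subtype.exists,
    exists_and_right, exists_eq_right, forall_exists_index]
  exact forall₃_congr fun _ _ _ => eq_comm

theorem IsSaturated.padicValNat_card_autFixing [Fact p.Prime] [Finite S] (hF : F.IsSaturated p)
    (hP : F.FullyNormalized P) (hT : F.FullyNormalized (Subgroup.normalizer (P : Set S))) :
    padicValNat p (Nat.card (F.autFixing (P.subgroupOf (Subgroup.normalizer (P : Set S))))) +
        padicValNat p (Nat.card (Subgroup.centralizer
          ((Subgroup.normalizer (P : Set S) : Subgroup S) : Set S))) =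
      padicValNat p (Nat.card (Subgroup.centralizer (P : Set S))) := by
  set T := Subgroup.normalizer (P : Set S)
  obtain ⟨β, hβ, hcard⟩ := hF.exists_padicValNat_card_autS_inf hT
    (L := F.autFixing (P.subgroupOf T)) inf_le_left
  let P' : Subgroup S := ((P.subgroupOf T).map β.toMonoidHom).map T.subtype
  have hmor : F.IsMor (T.subtype.comp β.toMonoidHom) := isMor_of_mem_hom hβ
  have hP' : P' = (P.subgroupOf T).map (T.subtype.comp β.toMonoidHom) := Subgroup.map_map ..
  have hN : Subgroup.normalizer (P' : Set S) = T := by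
    rw [hP', hP.normalizer_map hmor, range_subtype_comp_mulEquiv]
  have hC : Nat.card (Subgroup.centralizer (P : Set S)) =
      Nat.card (Subgroup.centralizer (P' : Set S)) := by
    rw [hP']
    exact (hF.fullyCentralized _ hP).card_eq (hF.fullyCentralized _ (hP.map hmor))
      (hmor.isConj_map Subgroup.le_normalizer)
  have hmul := card_map_normalizerMonoidHom_mul (T := T)
    (Subgroup.centralizer_le (show (P' : Set S) ⊆ T from Subgroup.map_subtype_le _))
    ((Subgroup.centralizer_le_normalizer (P' : Set S)).trans (hN.le.trans Subgroup.le_normalizer))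
  rw [conj_smul_autFixing hβ, autFixing, ← inf_assoc, inf_eq_left.2 (autS_le_aut T),
    autS_inf_fixingSubgroup] at hcard
  rw [← hcard, hC, ← hmul, padicValNat.mul Nat.card_pos.ne' Nat.card_pos.ne']

end FusionSystem

/-! ### The number of morphisms -/

theorem prime_mul_dvd_prime_pow {p m k : ℕ} (hp : p.Prime) (h : m ∣ p ^ k) (hne : m ≠ p ^ k) :
    p * m ∣ p ^ k := by
  obtain ⟨i, hi, rfl⟩ := (Nat.dvd_prime_pow hp).1 h
  rw [← pow_succ']
  exact pow_dvd_pow p (hi.lt_of_ne fun hik => hne (hik ▸ rfl))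

theorem padicValNat_eq_of_pow_dvd_sub {p m n : ℕ} [Fact p.Prime] (hm : m ≠ 0) (hn : n ≠ 0)
    (h : (p : ℤ) ^ (padicValNat p n + 1) ∣ m - n) : padicValNat p m = padicValNat p n := by
  have hiff : ∀ j ≤ padicValNat p n + 1, j ≤ padicValNat p m ↔ j ≤ padicValNat p n := by
    intro j hj
    rw [← padicValNat_dvd_iff_le hm, ← padicValNat_dvd_iff_le hn, ← Int.natCast_dvd_natCast,
      ← Int.natCast_dvd_natCast, Nat.cast_pow]
    exact dvd_iff_dvd_of_dvd_sub ((pow_dvd_pow _ hj).trans h)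
  have hle := (hiff _ (Nat.le_succ _)).2 le_rfl
  have hlt := (hiff _ le_rfl).not.2 (Nat.not_succ_le_self _)
  omega

theorem card_dvd_card_of_isPGroup {p : ℕ} [Fact p.Prime] {G : Type*} [Group G] [Finite G]
    (hG : IsPGroup p G) {H K : Subgroup G} (h : Nat.card H ≤ Nat.card K) :
    Nat.card H ∣ Nat.card K := by
  obtain ⟨m, hm⟩ := IsPGroup.iff_card.1 (hG.to_subgroup H)
  obtain ⟨n, hn⟩ := IsPGroup.iff_card.1 (hG.to_subgroup K)
  rw [hm, hn] at h ⊢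
  exact pow_dvd_pow p ((Nat.pow_le_pow_iff_right (Fact.out : p.Prime).one_lt).1 h)

theorem dvd_sum_of_dvd_card_orbit_mul (G : Type*) {X R : Type*} [Group G] [Fintype X]
    [MulAction G X] [CommSemiring R] {f : X → R} (hf : ∀ (g : G) x, f (g • x) = f x) {d : R}
    (hd : ∀ x, d ∣ Nat.card (MulAction.orbit G x) * f x) : d ∣ ∑ x, f x := by
  classical
  rw [← (MulAction.selfEquivSigmaOrbits G X).symm.sum_comp, Fintype.sum_sigma]
  refine Finset.dvd_sum fun ω _ => ?_
  have hconst : ∀ y : MulAction.orbit G ω.out,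
      f ((MulAction.selfEquivSigmaOrbits G X).symm ⟨ω, y⟩) = f ω.out := by
    rintro ⟨_, g, rfl⟩
    exact hf g _
  rw [Finset.sum_congr rfl fun y _ => hconst y, Finset.sum_const, Finset.card_univ, nsmul_eq_mul,
    ← Nat.card_eq_fintype_card]
  exact hd _

namespace FusionSystem

variable {S : Type u} [Group S] {F : FusionSystem S} {P Q T : Subgroup S} {p : ℕ}

variable (F) in
/-- The set of morphisms of `F` from `P` to `S`. -/
abbrev Mor (P : Subgroup S) : Type u := {φ : P →* S // F.IsMor φ}

instance [Finite S] (P : Subgroup S) : Finite (F.Mor P) :=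
  haveI : Finite (P →* S) := DFunLike.finite _
  Subtype.finite

instance (P : Subgroup S) : Nonempty (F.Mor P) := ⟨⟨_, isMor_subtype P⟩⟩

theorem IsConj.card_mor_eq (h : F.IsConj P Q) : Nat.card (F.Mor P) = Nat.card (F.Mor Q) := by
  obtain ⟨χ, hχ, rfl⟩ := isConj_iff_exists_isMor.1 h
  let e := MonoidHom.ofInjective hχ.injective
  exact Nat.card_congr
    { toFun φ := ⟨φ.1.comp e.symm.toMonoidHom, φ.2.comp hχ.ofInjective_symm_mem_hom⟩
      invFun φ := ⟨φ.1.comp e.toMonoidHom, φ.2.comp hχ.ofInjective_mem_hom⟩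
      left_inv φ := Subtype.ext (MonoidHom.ext fun x => congrArg φ.1 (e.symm_apply_apply x))
      right_inv φ := Subtype.ext (MonoidHom.ext fun x => congrArg φ.1 (e.apply_symm_apply x)) }

/-- Precomposition by `A` makes the fibres of `f` principal homogeneous. -/
theorem card_mor_eq_card_mul {β : Type*} {A : Subgroup (MulAut P)} (hA : A ≤ F.aut P)
    {f : F.Mor P → β} (hsurj : Function.Surjective f)
    (hf : ∀ φ ψ : F.Mor P, f φ = f ψ ↔ ∃ α ∈ A, ψ.1.comp α.toMonoidHom = φ.1) :
    Nat.card (F.Mor P) = Nat.card β * Nat.card A := by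
  choose s hs using hsurj
  let g : β × A → F.Mor P := fun x =>
    ⟨(s x.1).1.comp (x.2 : MulAut P).toMonoidHom, (s x.1).2.comp (hA x.2.2)⟩
  have hg : ∀ x, f (g x) = x.1 := fun x => ((hf _ _).2 ⟨x.2, x.2.2, rfl⟩).trans (hs x.1)
  rw [← Nat.card_prod]
  refine (Nat.card_eq_of_bijective g ⟨?_, fun φ => ?_⟩).symm
  · rintro ⟨b, α⟩ ⟨c, γ⟩ h
    obtain rfl : b = c := (hg (b, α)).symm.trans ((congrArg f h).trans (hg (c, γ)))
    refine Prod.ext rfl (Subtype.ext (MulEquiv.ext fun x => (s b).2.injective ?_))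
    exact DFunLike.congr_fun (congrArg Subtype.val h) x
  · obtain ⟨α, hα, h⟩ := (hf φ (s (f φ))).1 (hs _).symm
    exact ⟨(f φ, ⟨α, hα⟩), Subtype.ext h⟩

theorem card_mor [Finite S] (P : Subgroup S) :
    Nat.card (F.Mor P) = (F.conjClass P).card * Nat.card (F.aut P) := by
  let f : F.Mor P → F.conjClass P := fun φ => ⟨φ.1.range, mem_conjClass.2 φ.2.isConj⟩
  have hsurj : Function.Surjective f := by
    rintro ⟨Q, hQ⟩
    obtain ⟨φ, hφ, rfl⟩ := isConj_iff_exists_isMor.1 (mem_conjClass.1 hQ)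
    exact ⟨⟨φ, hφ⟩, rfl⟩
  rw [card_mor_eq_card_mul (A := F.aut P) le_rfl hsurj fun φ ψ => ⟨fun h =>
    φ.2.exists_comp_eq_of_range_eq ψ.2 (congrArg Subtype.val h), fun ⟨α, _, h⟩ => Subtype.ext ?_⟩,
    Nat.card_eq_fintype_card, Fintype.card_coe]
  change φ.1.range = ψ.1.range
  rw [← h, MonoidHom.range_comp, MonoidHom.range_eq_top.2 α.surjective, MonoidHom.range_eq_map]

/-- Restriction of a morphism to a smaller subgroup. -/
def Mor.restrict (h : P ≤ T) (ψ : F.Mor T) : F.Mor P :=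
  ⟨ψ.1.comp (Subgroup.inclusion h), ψ.2.comp (inclusion_mem_hom h)⟩

variable (F) in
/-- The morphisms `P → S` that extend to the normalizer of `P`. -/
def extendable (P : Subgroup S) : Set (F.Mor P) :=
  Set.range (Mor.restrict Subgroup.le_normalizer : F.Mor (Subgroup.normalizer (P : Set S)) → _)

instance (P : Subgroup S) : Nonempty (F.extendable P) := (Set.range_nonempty _).to_subtype

theorem FullyNormalized.card_mor_normalizer [Finite S] (hP : F.FullyNormalized P) :
    Nat.card (F.Mor (Subgroup.normalizer (P : Set S))) = Nat.card (F.extendable P) *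
      Nat.card (F.autFixing (P.subgroupOf (Subgroup.normalizer (P : Set S)))) := by
  refine card_mor_eq_card_mul inf_le_left Set.rangeFactorization_surjective fun φ ψ =>
    Subtype.ext_iff.trans ?_
  constructor
  · intro h
    have heq : ∀ x ∈ P.subgroupOf (Subgroup.normalizer (P : Set S)), φ.1 x = ψ.1 x :=
      fun x hx => DFunLike.congr_fun (congrArg Subtype.val h) (⟨x, hx⟩ : P)
    have hmap : (P.subgroupOf (Subgroup.normalizer (P : Set S))).map φ.1 =
        (P.subgroupOf (Subgroup.normalizer (P : Set S))).map ψ.1 :=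
      SetLike.coe_injective (Set.image_congr heq)
    obtain ⟨α, hα, hαφ⟩ := φ.2.exists_comp_eq_of_range_eq ψ.2
      (by rw [← hP.normalizer_map φ.2, hmap, hP.normalizer_map ψ.2])
    refine ⟨α, ⟨hα, mem_fixingSubgroup_iff _ |>.2 fun x hx => ψ.2.injective ?_⟩, hαφ⟩
    exact (DFunLike.congr_fun hαφ x).trans (heq x hx)
  · rintro ⟨α, ⟨-, hα⟩, hαφ⟩
    refine Subtype.ext (MonoidHom.ext fun x => ?_)
    have hx := (mem_fixingSubgroup_iff _).1 hα (Subgroup.inclusion Subgroup.le_normalizer x) x.2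
    exact (DFunLike.congr_fun hαφ _).symm.trans (congrArg ψ.1 hx)

/-- `S × N_S(P)` acts on the morphisms from `P` to `S` by conjugation on both sides. -/
instance morAction (F : FusionSystem S) (P : Subgroup S) :
    MulAction (S × Subgroup.normalizer (P : Set S)) (F.Mor P) where
  smul g φ := ⟨(MulAut.conj g.1).toMonoidHom.comp
    (φ.1.comp (P.normalizerMonoidHom g.2⁻¹).toMonoidHom),
    (φ.2.comp (autS_le_aut P ⟨_, rfl⟩)).conj_comp g.1⟩
  one_smul φ := Subtype.ext (MonoidHom.ext fun x => by
    change (1 : S) * φ.1 (P.normalizerMonoidHom (1 : Subgroup.normalizer (P : Set S))⁻¹ x) * 1⁻¹ = _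
    simp)
  mul_smul g h φ := Subtype.ext (MonoidHom.ext fun x => by
    change (g.1 * h.1) * φ.1 (P.normalizerMonoidHom (g.2 * h.2)⁻¹ x) * (g.1 * h.1)⁻¹ =
      g.1 * (h.1 * φ.1 (P.normalizerMonoidHom h.2⁻¹ (P.normalizerMonoidHom g.2⁻¹ x)) * h.1⁻¹) *
        g.1⁻¹
    rw [mul_inv_rev g.2, map_mul, MulAut.mul_apply]
    group)

theorem Mor.smul_apply (g : S × Subgroup.normalizer (P : Set S)) (φ : F.Mor P) (x : P) :
    (g • φ).1 x = g.1 * φ.1 (P.normalizerMonoidHom g.2⁻¹ x) * g.1⁻¹ := rfl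

theorem Mor.mem_stabilizer_iff {g : S × Subgroup.normalizer (P : Set S)} {φ : F.Mor P} :
    g ∈ MulAction.stabilizer _ φ ↔
      ∀ x : P, φ.1 (P.normalizerMonoidHom g.2 x) = g.1 * φ.1 x * g.1⁻¹ := by
  rw [MulAction.mem_stabilizer_iff, smul_eq_iff_eq_inv_smul, Subtype.ext_iff, DFunLike.ext_iff]
  refine forall_congr' fun x => ?_
  rw [Mor.smul_apply]
  simp only [Prod.fst_inv, Prod.snd_inv, inv_inv]
  constructor <;> intro h
  · rw [h]; group
  · rw [h]; group

theorem Mor.card_stabilizer (φ : F.Mor P) :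
    Nat.card (MulAction.stabilizer (S × Subgroup.normalizer (P : Set S)) φ) =
      Nat.card (extender (toTop φ.1)) * Nat.card (Subgroup.centralizer (φ.1.range : Set S)) := by
  have hle : extender (toTop φ.1) ≤ Subgroup.normalizer (P : Set S) := fun t ht => ht.1
  choose y hy using fun t : extender (toTop φ.1) =>
    (mem_extender_toTop_iff (φ := φ.1) ⟨t, hle t.2⟩).1 t.2
  have hmem : ∀ (s : S) (t : extender (toTop φ.1)),
      (s, ⟨t, hle t.2⟩) ∈ MulAction.stabilizer (S × Subgroup.normalizer (P : Set S)) φ ↔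
        (y t)⁻¹ * s ∈ Subgroup.centralizer (φ.1.range : Set S) := by
    intro s t
    rw [Mor.mem_stabilizer_iff, Subgroup.mem_centralizer_iff, MonoidHom.coe_range,
      Set.forall_mem_range]
    refine forall_congr' fun x => ?_
    rw [hy t x, eq_mul_inv_iff_mul_eq, mul_assoc _⁻¹ s, eq_inv_mul_iff_mul_eq]
    simp only [mul_assoc]
  rw [← Nat.card_prod]
  have hext : ∀ g : MulAction.stabilizer (S × Subgroup.normalizer (P : Set S)) φ,
      (g.1.2 : S) ∈ extender (toTop φ.1) := fun g =>
    (mem_extender_toTop_iff g.1.2).2 ⟨_, Mor.mem_stabilizer_iff.1 g.2⟩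
  exact Nat.card_congr
    { toFun g := (⟨g.1.2, hext g⟩, ⟨_, (hmem g.1.1 ⟨g.1.2, hext g⟩).1 g.2⟩)
      invFun x := ⟨(y x.1 * x.2, ⟨x.1, hle x.1.2⟩), (hmem _ _).2 (by simp)⟩
      left_inv g := by simp
      right_inv x := Prod.ext rfl (Subtype.ext (inv_mul_cancel_left _ _)) }

theorem Mor.smul_mem_extendable (g : S × Subgroup.normalizer (P : Set S)) {φ : F.Mor P}
    (h : φ ∈ F.extendable P) : g • φ ∈ F.extendable P := by
  obtain ⟨ψ, rfl⟩ := h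
  refine ⟨⟨_, ψ.2.conj_comp (g.1 * (ψ.1 g.2)⁻¹)⟩, Subtype.ext (MonoidHom.ext fun x => ?_)⟩
  have hx : Subgroup.inclusion Subgroup.le_normalizer (P.normalizerMonoidHom g.2⁻¹ x) =
      g.2⁻¹ * Subgroup.inclusion Subgroup.le_normalizer x * g.2 := by
    ext
    simp
  calc g.1 * (ψ.1 g.2)⁻¹ * ψ.1 (Subgroup.inclusion Subgroup.le_normalizer x) *
        (g.1 * (ψ.1 g.2)⁻¹)⁻¹
      = g.1 * ψ.1 (g.2⁻¹ * Subgroup.inclusion Subgroup.le_normalizer x * g.2) * g.1⁻¹ := by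
        rw [map_mul, map_mul, map_inv]
        group
    _ = g.1 * ψ.1 (Subgroup.inclusion Subgroup.le_normalizer (P.normalizerMonoidHom g.2⁻¹ x)) *
          g.1⁻¹ := by rw [hx]

theorem IsSaturated.mem_extendable (hF : F.IsSaturated p) {φ : F.Mor P}
    (hc : F.FullyCentralized φ.1.range)
    (hN : Subgroup.normalizer (P : Set S) ≤ extender (toTop φ.1)) : φ ∈ F.extendable P := by
  obtain ⟨ψ, hψ, h⟩ := hF.exists_extension φ.2 hc Subgroup.le_normalizer hN
  exact ⟨⟨ψ, hψ⟩, Subtype.ext h⟩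

theorem IsSaturated.dvd_card_orbit [Fact p.Prime] [Finite S] (hS : IsPGroup p S)
    (hF : F.IsSaturated p) (hP : F.FullyCentralized P) {φ : F.Mor P} (hφ : φ ∉ F.extendable P) :
    p * (Subgroup.centralizer (P : Set S)).index ∣
      Nat.card (MulAction.orbit (S × Subgroup.normalizer (P : Set S)) φ) := by
  set C := Subgroup.centralizer (P : Set S)
  set N := Subgroup.normalizer (P : Set S)
  have hle : extender (toTop φ.1) ≤ N := fun t ht => ht.1
  have hdvd : Nat.card (MulAction.stabilizer (S × N) φ) ∣ Nat.card N * Nat.card C := by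
    rw [Mor.card_stabilizer]
    exact mul_dvd_mul (Subgroup.card_dvd_of_le hle)
      (card_dvd_card_of_isPGroup hS (hP _ φ.2.isConj))
  have hne : Nat.card (MulAction.stabilizer (S × N) φ) ≠ Nat.card N * Nat.card C := by
    rw [Mor.card_stabilizer]
    intro heq
    obtain ⟨hN, hC⟩ := (mul_eq_mul_iff_eq_and_eq_of_pos (Subgroup.card_le_of_le hle)
      (hP _ φ.2.isConj) Nat.card_pos Nat.card_pos).1 heq
    exact hφ (hF.mem_extendable (hP.of_isConj φ.2.isConj hC.ge)
      (Subgroup.eq_of_le_of_card_ge hle hN.ge).ge)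
  obtain ⟨k, hk⟩ : ∃ k, Nat.card N * Nat.card C = p ^ k := by
    obtain ⟨i, hi⟩ := IsPGroup.iff_card.1 (hS.to_subgroup N)
    obtain ⟨j, hj⟩ := IsPGroup.iff_card.1 (hS.to_subgroup C)
    exact ⟨i + j, by rw [hi, hj, pow_add]⟩
  have hstep := prime_mul_dvd_prime_pow Fact.out (hk ▸ hdvd) (hk ▸ hne)
  refine Nat.dvd_of_mul_dvd_mul_right
    (Nat.card_pos (α := MulAction.stabilizer (S × N) φ)) ?_
  rw [← Nat.card_prod (MulAction.orbit (S × N) φ),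
    Nat.card_congr (MulAction.orbitProdStabilizerEquivGroup (S × N) φ), Nat.card_prod,
    ← C.card_mul_index]
  calc p * C.index * Nat.card (MulAction.stabilizer (S × N) φ)
      = C.index * (p * Nat.card (MulAction.stabilizer (S × N) φ)) := by ring
    _ ∣ C.index * p ^ k := mul_dvd_mul_left _ hstep
    _ = Nat.card C * C.index * Nat.card N := by rw [← hk]; ring

theorem IsSaturated.dvd_card_mor_sub [Fact p.Prime] [Finite S] (hS : IsPGroup p S)
    (hF : F.IsSaturated p) (hP : F.FullyCentralized P) :
    (p * (Subgroup.centralizer (P : Set S)).index : ℤ) ∣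
      Nat.card (F.Mor P) - Nat.card (F.extendable P) := by
  classical
  have := Fintype.ofFinite (F.Mor P)
  set E := F.extendable P
  have hinv : ∀ (g : S × Subgroup.normalizer (P : Set S)) (φ : F.Mor P), g • φ ∈ E ↔ φ ∈ E :=
    fun g φ => ⟨fun h => inv_smul_smul g φ ▸ Mor.smul_mem_extendable g⁻¹ h,
      Mor.smul_mem_extendable g⟩
  have hsum : ∑ φ : F.Mor P, (if φ ∈ E then (0 : ℤ) else 1) =
      Nat.card (F.Mor P) - Nat.card E := by
    have hE : Nat.card E = (Finset.univ.filter (· ∈ E)).card := by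
      rw [Nat.card_eq_fintype_card, ← Fintype.card_subtype]
    rw [hE, Nat.card_eq_fintype_card, ← Finset.card_univ,
      ← Finset.card_filter_add_card_filter_not (s := Finset.univ) (· ∈ E), Nat.cast_add,
      add_sub_cancel_left, Finset.sum_ite, Finset.sum_const_zero, zero_add, Finset.sum_const,
      nsmul_one]
  rw [← hsum]
  refine dvd_sum_of_dvd_card_orbit_mul (S × Subgroup.normalizer (P : Set S))
    (fun g φ => by simp only [hinv]) fun φ => ?_
  by_cases hφ : φ ∈ E
  · simp only [hφ, if_true, mul_zero, dvd_zero]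
  · rw [if_neg hφ, mul_one]
    exact_mod_cast hF.dvd_card_orbit hS hP hφ

theorem IsSaturated.padicValNat_card_aut [Fact p.Prime] [Finite S] (hF : F.IsSaturated p)
    (hP : F.FullyNormalized P) :
    padicValNat p (Nat.card (F.aut P)) = padicValNat p (Nat.card (autS P)) := by
  obtain ⟨β, hβ, h⟩ := hF.exists_padicValNat_card_autS_inf hP le_rfl
  rw [← h, Subgroup.conj_smul_eq_self_of_mem hβ, inf_eq_left.2 (autS_le_aut P)]

theorem card_autS_mul (P : Subgroup S) :
    Nat.card (autS P) * Nat.card (Subgroup.centralizer (P : Set S)) =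
      Nat.card (Subgroup.normalizer (P : Set S)) := by
  rw [autS]
  simpa only [Subgroup.subgroupOf_self, ← MonoidHom.range_eq_map] using
    card_map_normalizerMonoidHom_mul (Subgroup.centralizer_le_normalizer (P : Set S)) le_rfl

theorem IsSaturated.padicValNat_card_mor_add [Fact p.Prime] [Finite S] (hF : F.IsSaturated p)
    (hP : F.FullyNormalized P) :
    padicValNat p (Nat.card (F.Mor P)) +
        padicValNat p (Nat.card (Subgroup.centralizer (P : Set S))) =
      padicValNat p (F.conjClass P).card +
        padicValNat p (Nat.card (Subgroup.normalizer (P : Set S))) := by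
  rw [card_mor, ← card_autS_mul, padicValNat.mul (card_conjClass_pos P).ne' Nat.card_pos.ne',
    padicValNat.mul Nat.card_pos.ne' Nat.card_pos.ne', hF.padicValNat_card_aut hP, add_assoc]

variable (F) in
theorem exists_fullyNormalized_normalizer [Finite S] (P : Subgroup S) :
    ∃ Q, F.IsConj P Q ∧ F.FullyNormalized Q ∧
      F.FullyNormalized (Subgroup.normalizer (Q : Set S)) := by
  obtain ⟨R, hPR, hR⟩ := F.exists_fullyNormalized P
  obtain ⟨T, hRT, hT⟩ := F.exists_fullyNormalized (Subgroup.normalizer (R : Set S))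
  obtain ⟨ψ, hψ, rfl⟩ := isConj_iff_exists_isMor.1 hRT
  refine ⟨_, hPR.trans (hψ.isConj_map Subgroup.le_normalizer), hR.map hψ, ?_⟩
  rwa [hR.normalizer_map hψ]

theorem IsSaturated.padicValNat_card_mor_of_normalizer [Fact p.Prime] [Finite S]
    (hS : IsPGroup p S) (hF : F.IsSaturated p) (hP : F.FullyNormalized P)
    (hN : F.FullyNormalized (Subgroup.normalizer (P : Set S)))
    (h : padicValNat p (Nat.card (F.Mor (Subgroup.normalizer (P : Set S)))) +
        padicValNat p (Nat.card (Subgroup.centralizer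
          ((Subgroup.normalizer (P : Set S) : Subgroup S) : Set S))) =
      padicValNat p (Nat.card S)) :
    padicValNat p (Nat.card (F.Mor P)) +
      padicValNat p (Nat.card (Subgroup.centralizer (P : Set S))) = padicValNat p (Nat.card S) := by
  have hE : Nat.card (F.extendable P) ≠ 0 := Nat.card_pos.ne'
  rw [hP.card_mor_normalizer, padicValNat.mul hE Nat.card_pos.ne', add_assoc,
    hF.padicValNat_card_autFixing hP hN] at h
  rw [← h]
  congr 1
  refine padicValNat_eq_of_pow_dvd_sub Nat.card_pos.ne' hE ?_
  obtain ⟨k, hk⟩ := hS.index (Subgroup.centralizer (P : Set S))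
  rw [← (Subgroup.centralizer (P : Set S)).card_mul_index, hk,
    padicValNat.mul Nat.card_pos.ne' (pow_ne_zero _ (Fact.out : p.Prime).ne_zero), add_comm,
    padicValNat.prime_pow, add_right_inj] at h
  have hdvd := hF.dvd_card_mor_sub hS (hF.fullyCentralized P hP)
  rw [hk, Nat.cast_pow, ← pow_succ'] at hdvd
  rwa [h]

theorem IsSaturated.padicValNat_card_mor [Fact p.Prime] [Finite S] (hS : IsPGroup p S)
    (hF : F.IsSaturated p) (hP : F.FullyCentralized P) :
    padicValNat p (Nat.card (F.Mor P)) +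
      padicValNat p (Nat.card (Subgroup.centralizer (P : Set S))) = padicValNat p (Nat.card S) := by
  induction hn : Nat.card S - Nat.card P using Nat.strong_induction_on generalizing P with
  | _ n ih =>
  obtain ⟨Q, hPQ, hQ, hN⟩ := F.exists_fullyNormalized_normalizer P
  rw [hPQ.card_mor_eq, hP.card_eq (hF.fullyCentralized Q hQ) hPQ]
  obtain rfl | htop := eq_or_ne Q ⊤
  · rw [hF.padicValNat_card_mor_add hQ, conjClass_top, Subgroup.normalizer_eq_top,
      Finset.card_singleton, padicValNat_one_right, zero_add, Subgroup.card_top]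
  · have hnil : Group.IsNilpotent S := hS.isNilpotent
    have hlt : Nat.card Q < Nat.card (Subgroup.normalizer (Q : Set S)) :=
      Set.ncard_lt_ncard (Group.normalizerCondition_of_isNilpotent Q htop.lt_top)
    refine hF.padicValNat_card_mor_of_normalizer hS hQ hN
      (ih _ ?_ (hF.fullyCentralized _ hN) rfl)
    have hle := Subgroup.card_le_card_group (Subgroup.normalizer (Q : Set S))
    rw [← hn, hPQ.card_eq]
    omega

theorem IsSaturated.padicValNat_card_conjClass [Fact p.Prime] [Finite S] (hS : IsPGroup p S)
    (hF : F.IsSaturated p) (hP : F.FullyNormalized P) :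
    padicValNat p (F.conjClass P).card +
      padicValNat p (Nat.card (Subgroup.normalizer (P : Set S))) = padicValNat p (Nat.card S) := by
  rw [← hF.padicValNat_card_mor_add hP, hF.padicValNat_card_mor hS (hF.fullyCentralized P hP)]

end FusionSystem

/-! ### Marks of transitive sets -/

theorem card_map_conj {G : Type*} [Group G] (P : Subgroup G) (s : G) :
    Nat.card (P.map (MulAut.conj s).toMonoidHom) = Nat.card P :=
  Subgroup.card_map_of_injective (MulAut.conj s).injective

theorem FinGSetClass.res_conj {G : Type u} [Group G] (s : G) (x : FinGSetClass G) :
    res (MulAut.conj s).toMonoidHom x = x := by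
  induction x using Quotient.inductionOn with
  | h X =>
  refine Quotient.sound
    ⟨(MulAction.toPerm s⁻¹ : Equiv.Perm X.carrier), fun g (x : X.carrier) => ?_⟩
  change s⁻¹ • (s * g * s⁻¹) • x = g • s⁻¹ • x
  simp only [← mul_smul, mul_assoc, inv_mul_cancel_left]

namespace BurnsideRing

variable {G : Type u} [Group G]

theorem mark_map_conj (P : Subgroup G) (s : G) (X : BurnsideRing G) :
    mark (P.map (MulAut.conj s).toMonoidHom) X = mark P X := by
  obtain ⟨a, b, rfl⟩ := exists_of_sub_of X
  rw [← mark_res, map_sub, res_of, res_of, FinGSetClass.res_conj, FinGSetClass.res_conj]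

/-- The class of the transitive `G`-set `G/P`. -/
noncomputable def coset (P : Subgroup G) [P.FiniteIndex] : BurnsideRing G :=
  GrothendieckRing.of (FinGSetClass.mk (.coset P))

variable [Finite G] {P Q : Subgroup G}

theorem card_mul_mark_coset (P Q : Subgroup G) :
    (Nat.card P : ℤ) * mark Q (coset P) =
      Nat.card {s : G // Q ≤ P.map (MulAut.conj s).toMonoidHom} := by
  have hstab : ∀ s : G, MulAction.stabilizer G (s : G ⧸ P) =
      P.map (MulAut.conj s).toMonoidHom := by
    intro s
    ext q
    rw [MulAction.mem_stabilizer_iff, Subgroup.mem_map_equiv, MulAction.Quotient.smul_coe,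
      eq_comm, QuotientGroup.eq, MulAut.conj_symm_apply, smul_eq_mul, mul_assoc]
  rw [coset, mark_of, FinGSetClass.mark_mk]
  norm_cast
  rw [← Nat.card_prod]
  refine (Nat.card_congr (QuotientGroup.preimageMkEquivSubgroupProdSet P
    (MulAction.fixedPoints Q (G ⧸ P)))).symm.trans
    (Nat.card_congr (Equiv.subtypeEquivRight fun s => ?_))
  rw [← hstab, ← mem_fixedPoints_iff_le_stabilizer]
  rfl

theorem exists_le_map_conj_of_mark_coset_ne_zero (h : mark Q (coset P) ≠ 0) :
    ∃ s, Q ≤ P.map (MulAut.conj s).toMonoidHom := by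
  by_contra! hs
  have hzero : Nat.card {s : G // Q ≤ P.map (MulAut.conj s).toMonoidHom} = 0 :=
    Nat.card_eq_zero.2 (.inl ⟨fun s => hs s.1 s.2⟩)
  have hmul := card_mul_mark_coset P Q
  rw [hzero, Nat.cast_zero, mul_eq_zero] at hmul
  exact hmul.elim (mod_cast Nat.card_pos.ne') h

theorem exists_eq_map_conj_of_mark_coset_ne_zero (h : mark Q (coset P) ≠ 0)
    (hcard : Nat.card P ≤ Nat.card Q) : ∃ s, Q = P.map (MulAut.conj s).toMonoidHom := by
  obtain ⟨s, hs⟩ := exists_le_map_conj_of_mark_coset_ne_zero h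
  exact ⟨s, Subgroup.eq_of_le_of_card_ge hs ((card_map_conj P s).trans_le hcard)⟩

theorem card_mul_mark_coset_self (P : Subgroup G) :
    (Nat.card P : ℤ) * mark P (coset P) = Nat.card (Subgroup.normalizer (P : Set G)) := by
  rw [card_mul_mark_coset]
  norm_cast
  refine Nat.card_congr (Equiv.subtypeEquivRight fun s => ?_)
  rw [Subgroup.mem_normalizer_iff_map_conj_eq]
  exact ⟨fun h => (Subgroup.eq_of_le_of_card_ge h (card_map_conj P s).le).symm, fun h => h.ge⟩

end BurnsideRing

namespace FusionSystem

open BurnsideRing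

variable {S : Type u} [Group S] {F : FusionSystem S} {P Q R : Subgroup S} [Finite S]

variable (F) in
/-- The sum of the marks over the conjugacy class of `Q`. -/
noncomputable def markSum (Q : Subgroup S) : BurnsideRing S →+ ℤ :=
  ∑ Q' ∈ F.conjClass Q, (mark Q').toAddMonoidHom

theorem markSum_apply (Q : Subgroup S) (X : BurnsideRing S) :
    F.markSum Q X = ∑ Q' ∈ F.conjClass Q, mark Q' X := by
  simp only [markSum, AddMonoidHom.finsetSum_apply]
  rfl

variable (F) in
/-- The number of conjugates of `Q` that are contained in `P`. -/
noncomputable def conjIn (Q P : Subgroup S) : ℕ := Nat.card {R // F.IsConj Q R ∧ R ≤ P}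

theorem IsConj.conjIn_le (h : F.IsConj P R) : F.conjIn Q P ≤ F.conjIn Q R := by
  obtain ⟨φ, hφ, rfl⟩ := isConj_iff_exists_isMor.1 h
  refine Nat.card_le_card_of_injective (fun T : {R // F.IsConj Q R ∧ R ≤ P} =>
    (⟨(T.1.subgroupOf P).map φ, T.2.1.trans (hφ.isConj_map T.2.2), Subgroup.map_le_range _ _⟩ :
      {R // F.IsConj Q R ∧ R ≤ φ.range})) ?_
  rintro ⟨T, hT⟩ ⟨T', hT'⟩ heq
  have hT_eq := Subgroup.map_injective hφ.injective (congrArg Subtype.val heq)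
  rw [Subgroup.subgroupOf_inj, inf_eq_left.2 hT.2, inf_eq_left.2 hT'.2] at hT_eq
  exact Subtype.ext hT_eq

theorem IsConj.conjIn_eq (h : F.IsConj P R) : F.conjIn Q P = F.conjIn Q R :=
  le_antisymm h.conjIn_le h.symm.conjIn_le

theorem conjIn_self (P : Subgroup S) : F.conjIn P P = 1 := by
  rw [conjIn, Nat.card_eq_one_iff_unique]
  refine ⟨⟨fun T T' => Subtype.ext ?_⟩, ⟨P, .refl P, le_rfl⟩⟩
  rw [Subgroup.eq_of_le_of_card_ge T.2.2 T.2.1.card_eq.le,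
    Subgroup.eq_of_le_of_card_ge T'.2.2 T'.2.1.card_eq.le]

theorem card_mul_markSum_coset (P Q : Subgroup S) :
    (Nat.card P : ℤ) * F.markSum Q (coset P) = Nat.card S * F.conjIn Q P := by
  have := Fintype.ofFinite S
  simp only [markSum_apply, Finset.mul_sum, card_mul_mark_coset]
  norm_cast
  rw [← Finset.sum_coe_sort, ← Nat.card_sigma]
  let e : (Σ Q' : F.conjClass Q, {s : S // (Q' : Subgroup S) ≤ P.map (MulAut.conj s).toMonoidHom})
      ≃ Σ s : S, {R // F.IsConj Q R ∧ R ≤ P.map (MulAut.conj s).toMonoidHom} :=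
    { toFun z := ⟨z.2.1, z.1.1, mem_conjClass.1 z.1.2, z.2.2⟩
      invFun z := ⟨⟨z.2.1, mem_conjClass.2 z.2.2.1⟩, z.1, z.2.2.2⟩ }
  rw [Nat.card_congr e, Nat.card_sigma]
  change ∑ s : S, F.conjIn Q (P.map (MulAut.conj s).toMonoidHom) = _
  simp only [← (isConj_map_conj (F := F) P _).conjIn_eq, Finset.sum_const, Finset.card_univ,
    smul_eq_mul, Nat.card_eq_fintype_card]

theorem IsConj.markSum_coset_eq (h : F.IsConj P R) (Q : Subgroup S) :
    F.markSum Q (coset P) = F.markSum Q (coset R) := by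
  have hP : (Nat.card P : ℤ) ≠ 0 := mod_cast Nat.card_pos.ne'
  refine mul_left_cancel₀ hP ?_
  rw [card_mul_markSum_coset, h.conjIn_eq, h.card_eq, card_mul_markSum_coset]

theorem markSum_coset_self_ne_zero (P : Subgroup S) : F.markSum P (coset P) ≠ 0 := by
  have hS : (Nat.card S : ℤ) ≠ 0 := mod_cast Nat.card_pos.ne'
  refine right_ne_zero_of_mul (a := (Nat.card P : ℤ)) ?_
  rwa [card_mul_markSum_coset, conjIn_self, Nat.cast_one, mul_one]

/-! ### The span of the sets `S/Q` with `Q` in a conjugacy class -/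

variable (F) in
/-- The subgroup of `A(S)` generated by the classes of `S/Q` for `Q` conjugate to `P`; the marks on
the class of `P` are corrected by its elements. -/
noncomputable def cosetSpan (P : Subgroup S) : AddSubgroup (BurnsideRing S) :=
  AddSubgroup.closure ((fun Q => coset Q) '' F.conjClass P)

theorem coset_mem_cosetSpan (h : F.IsConj P Q) : coset Q ∈ F.cosetSpan P :=
  AddSubgroup.subset_closure (Set.mem_image_of_mem _ (mem_conjClass.2 h))

theorem mark_eq_zero_of_mem_cosetSpan {M : BurnsideRing S} (hM : M ∈ F.cosetSpan P)
    (hQ : ¬ F.IsConj P Q) (hcard : Nat.card P ≤ Nat.card Q) : mark Q M = 0 := by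
  have hle : F.cosetSpan P ≤ (mark Q).toAddMonoidHom.ker := by
    refine (AddSubgroup.closure_le _).2 ?_
    rintro _ ⟨R, hR, rfl⟩
    have hPR : F.IsConj P R := mem_conjClass.1 hR
    by_contra hne
    obtain ⟨s, rfl⟩ := exists_eq_map_conj_of_mark_coset_ne_zero hne (hPR.card_eq ▸ hcard)
    exact hQ (hPR.trans (isConj_map_conj R s))
  exact hle hM

theorem exists_markSum_eq_mul {M : BurnsideRing S} (hM : M ∈ F.cosetSpan P) :
    ∃ l : ℤ, ∀ Q, F.markSum Q M = l * F.markSum Q (coset P) := by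
  induction hM using AddSubgroup.closure_induction with
  | mem _ h =>
    obtain ⟨R, hR, rfl⟩ := h
    exact ⟨1, fun Q => by rw [one_mul, (mem_conjClass.1 hR).markSum_coset_eq]⟩
  | zero => exact ⟨0, fun Q => by rw [map_zero, zero_mul]⟩
  | add _ _ _ _ hX hY =>
    obtain ⟨⟨l, hl⟩, m, hm⟩ := And.intro hX hY
    exact ⟨l + m, fun Q => by rw [map_add, hl, hm, add_mul]⟩
  | neg _ _ hX =>
    obtain ⟨l, hl⟩ := hX
    exact ⟨-l, fun Q => by rw [map_neg, hl, neg_mul]⟩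

theorem markSum_eq_zero_of_mem_cosetSpan {M : BurnsideRing S} (hM : M ∈ F.cosetSpan P)
    (h : F.markSum P M = 0) (Q : Subgroup S) : F.markSum Q M = 0 := by
  obtain ⟨l, hl⟩ := exists_markSum_eq_mul hM
  have hl_zero : l = 0 := by
    rw [hl] at h
    exact (mul_eq_zero.1 h).resolve_right (markSum_coset_self_ne_zero P)
  rw [hl, hl_zero, zero_mul]

/-- `S` acts on a conjugacy class of subgroups by conjugation. -/
instance conjClassAction (F : FusionSystem S) (P : Subgroup S) :
    MulAction S (F.conjClass P) where
  smul s Q := ⟨Q.1.map (MulAut.conj s).toMonoidHom,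
    mem_conjClass.2 ((mem_conjClass.1 Q.2).trans (isConj_map_conj _ s))⟩
  one_smul Q := Subtype.ext (by
    change Q.1.map (MulAut.conj 1).toMonoidHom = Q.1
    rw [map_one]
    exact Subgroup.map_id _)
  mul_smul s t Q := Subtype.ext (by
    change Q.1.map (MulAut.conj (s * t)).toMonoidHom =
      (Q.1.map (MulAut.conj t).toMonoidHom).map (MulAut.conj s).toMonoidHom
    rw [map_mul, Subgroup.map_map]
    rfl)

theorem coe_smul_conjClass (s : S) (Q : F.conjClass P) :
    ((s • Q : F.conjClass P) : Subgroup S) = Q.1.map (MulAut.conj s).toMonoidHom := rfl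

theorem card_orbit_conjClass_mul (Q : F.conjClass P) :
    Nat.card (MulAction.orbit S Q) * Nat.card (Subgroup.normalizer (Q.1 : Set S)) =
      Nat.card S := by
  have hstab : MulAction.stabilizer S Q = Subgroup.normalizer (Q.1 : Set S) := by
    ext s
    rw [MulAction.mem_stabilizer_iff, Subgroup.mem_normalizer_iff_map_conj_eq, Subtype.ext_iff,
      coe_smul_conjClass]
    rfl
  rw [← hstab, ← Nat.card_prod]
  exact Nat.card_congr (MulAction.orbitProdStabilizerEquivGroup S Q)

theorem exists_mem_cosetSpan_mark_eq {g : F.conjClass P → ℤ} (hg : ∀ (s : S) Q, g (s • Q) = g Q)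
    (hdvd : ∀ Q : F.conjClass P,
      (Nat.card (Subgroup.normalizer (Q.1 : Set S)) : ℤ) ∣ Nat.card P * g Q) :
    ∃ M ∈ F.cosetSpan P, ∀ Q : F.conjClass P, mark Q.1 M = g Q := by
  have := Fintype.ofFinite (MulAction.orbitRel.Quotient S (F.conjClass P))
  have hcard : ∀ Q : F.conjClass P, Nat.card P = Nat.card Q.1 := fun Q =>
    (mem_conjClass.1 Q.2).card_eq
  choose l hl using hdvd
  have hself : ∀ Q : F.conjClass P, l Q * mark Q.1 (coset Q.1) = g Q := by
    intro Q
    have hP : (Nat.card P : ℤ) ≠ 0 := mod_cast Nat.card_pos.ne'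
    refine mul_left_cancel₀ hP ?_
    rw [hl, ← card_mul_mark_coset_self, hcard Q]
    ring
  let rep : MulAction.orbitRel.Quotient S (F.conjClass P) → F.conjClass P := Quotient.out
  refine ⟨∑ ω, l (rep ω) • coset (rep ω).1, sum_mem fun ω _ =>
    zsmul_mem (coset_mem_cosetSpan (mem_conjClass.1 (rep ω).2)) _, fun Q => ?_⟩
  simp only [map_sum, map_zsmul, smul_eq_mul]
  rw [Finset.sum_eq_single (Quotient.mk'' Q) (fun ω _ hω => ?_)
    fun h => absurd (Finset.mem_univ _) h]
  · obtain ⟨s, hs⟩ : Q ∈ MulAction.orbit S (rep (Quotient.mk'' Q)) :=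
      MulAction.orbitRel_apply.1 (Quotient.exact' (Quotient.out_eq' _).symm)
    generalize rep (Quotient.mk'' Q) = Q₀ at hs
    obtain rfl : s • Q₀ = Q := hs
    rw [coe_smul_conjClass, mark_map_conj, hself, hg]
  · by_contra hne
    obtain ⟨s, hs⟩ := exists_eq_map_conj_of_mark_coset_ne_zero (right_ne_zero_of_mul hne)
      ((hcard _).symm.trans (hcard Q)).le
    refine hω ?_
    rw [← Quotient.out_eq' ω]
    exact Quotient.sound' (MulAction.orbitRel_apply.2
      (MulAction.mem_orbit_symm.1 ⟨s, (Subtype.ext hs).symm⟩))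

end FusionSystem

/-! ### Stabilization -/

namespace FusionSystem

open BurnsideRing

variable {S : Type u} [Group S] {F : FusionSystem S} {P Q : Subgroup S} {X Y Z : BurnsideRing S}
  {p : ℕ}

variable (F) in
/-- The marks of `X` are constant on the conjugacy class of `Q`. -/
def StableAt (X : BurnsideRing S) (Q : Subgroup S) : Prop :=
  ∀ Q', F.IsConj Q Q' → mark Q' X = mark Q X

theorem StableAt.of_isConj (h : F.StableAt X P) (hPQ : F.IsConj P Q) : F.StableAt X Q :=
  fun R hR => (h R (hPQ.trans hR)).trans (h Q hPQ).symm

theorem IsMor.isConj_map_subtype {φ : P →* S} (hφ : F.IsMor φ) (R : Subgroup P) :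
    F.IsConj (R.map P.subtype) (R.map φ) := by
  have h := hφ.isConj_map (Subgroup.map_subtype_le R)
  rwa [← Subgroup.comap_subtype,
    Subgroup.comap_map_eq_self_of_injective P.subtype_injective] at h

theorem mem_burnside_iff : X ∈ F.burnside ↔ ∀ Q, F.StableAt X Q := by
  constructor
  · intro h Q Q' hQ
    obtain ⟨φ, hφ, rfl⟩ := isConj_iff_exists_isMor.1 hQ
    have hmark := congrArg (mark ⊤) (h Q _ hφ)
    rw [mark_res, mark_res, ← MonoidHom.range_eq_map, ← MonoidHom.range_eq_map,
      Subgroup.range_subtype] at hmark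
    exact hmark
  · intro h P φ hφ
    refine ext_mark fun R => ?_
    rw [mark_res, mark_res]
    exact h _ _ ((isMor_of_mem_hom hφ).isConj_map_subtype R)

variable [Finite S]

/-- A morphism `φ : N_S(Q) → S` with `φ(Q) = P` exists, and the restrictions of `X` to `N_S(Q)`
along the inclusion and along `φ` have the same marks on all subgroups strictly above `Q`. -/
theorem IsSaturated.card_normalizer_dvd_card_mul_mark_sub [Fact p.Prime] (hS : IsPGroup p S)
    (hF : F.IsSaturated p) (hP : F.FullyNormalized P)
    (hX : ∀ Q : Subgroup S, Nat.card P < Nat.card Q → F.StableAt X Q) (hQ : F.IsConj P Q) :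
    (Nat.card (Subgroup.normalizer (Q : Set S)) : ℤ) ∣
      Nat.card P * (mark Q X - mark P X) := by
  obtain ⟨φ, hφ, hφQ⟩ := hF.exists_isMor_normalizer_map_eq hS hP hQ.symm
  set Q' := Q.subgroupOf (Subgroup.normalizer (Q : Set S))
  have hmap : Q'.map (Subgroup.normalizer (Q : Set S)).subtype = Q :=
    Subgroup.map_subgroupOf_eq_of_le Subgroup.le_normalizer
  have hcard : Nat.card Q' = Nat.card P :=
    (Nat.card_congr (Subgroup.subgroupOfEquivOfLe Subgroup.le_normalizer).toEquiv).trans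
      hQ.card_eq.symm
  have hmark : ∀ R, mark R (res (Subgroup.normalizer (Q : Set S)).subtype X - res φ X) =
      mark (R.map (Subgroup.normalizer (Q : Set S)).subtype) X - mark (R.map φ) X := fun R => by
    rw [map_sub, mark_res, mark_res]
  have hdvd := card_dvd_card_mul_mark Q' fun R hR => by
    rw [hmark, sub_eq_zero]
    refine (hX _ ?_ _ (hφ.isConj_map_subtype R)).symm
    rw [Subgroup.card_map_of_injective (Subgroup.subtype_injective _), ← hcard]
    exact Set.ncard_lt_ncard hR
  rwa [hmark, hmap, hφQ, hcard] at hdvd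

theorem IsSaturated.exists_card_conjClass_eq_mul_index [Fact p.Prime] (hS : IsPGroup p S)
    (hF : F.IsSaturated p) (hP : F.FullyNormalized P) :
    ∃ k, ¬ p ∣ k ∧
      (F.conjClass P).card = k * (Subgroup.normalizer (P : Set S)).index := by
  obtain ⟨j, hj⟩ := hS.index (Subgroup.normalizer (P : Set S))
  have hval := hF.padicValNat_card_conjClass hS hP
  rw [← (Subgroup.normalizer (P : Set S)).card_mul_index, hj,
    padicValNat.mul Nat.card_pos.ne' (pow_ne_zero _ (Fact.out : p.Prime).ne_zero), add_comm,
    padicValNat.prime_pow, add_right_inj] at hval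
  obtain ⟨k, hk⟩ : p ^ j ∣ (F.conjClass P).card := hval ▸ pow_padicValNat_dvd
  refine ⟨k, fun ⟨m, hm⟩ =>
    pow_succ_padicValNat_not_dvd (p := p) (card_conjClass_pos (F := F) P).ne' ?_,
    by rw [hk, hj, mul_comm]⟩
  exact ⟨m, by rw [hval, hk, hm, pow_succ, mul_assoc]⟩

theorem IsSaturated.exists_index_mul_eq_sum_mark_sub [Fact p.Prime] (hS : IsPGroup p S)
    (hF : F.IsSaturated p) (hP : F.FullyNormalized P)
    (hX : ∀ Q : Subgroup S, Nat.card P < Nat.card Q → F.StableAt X Q) :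
    ∃ c : ℤ, (Nat.card (Subgroup.normalizer (P : Set S)) : ℤ) ∣ Nat.card P * c ∧
      (Subgroup.normalizer (P : Set S)).index * c =
        ∑ Q : F.conjClass P, (mark Q.1 X - mark P X) := by
  set N := Subgroup.normalizer (P : Set S)
  have hdvd : (Nat.card S : ℤ) ∣ ∑ Q : F.conjClass P, Nat.card P * (mark Q.1 X - mark P X) := by
    refine dvd_sum_of_dvd_card_orbit_mul S
      (fun s Q => by rw [coe_smul_conjClass, mark_map_conj]) fun Q => ?_
    rw [← card_orbit_conjClass_mul Q, Nat.cast_mul]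
    exact mul_dvd_mul_left _
      (hF.card_normalizer_dvd_card_mul_mark_sub hS hP hX (mem_conjClass.1 Q.2))
  obtain ⟨m, hm⟩ := hdvd
  obtain ⟨w, hw⟩ : Nat.card P ∣ Nat.card N := Subgroup.card_dvd_of_le Subgroup.le_normalizer
  have hP_ne : (Nat.card P : ℤ) ≠ 0 := mod_cast Nat.card_pos.ne'
  refine ⟨w * m, ⟨m, by rw [hw, Nat.cast_mul, mul_assoc]⟩, mul_left_cancel₀ hP_ne ?_⟩
  rw [Finset.mul_sum, hm, ← N.card_mul_index, hw]
  push_cast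
  ring

theorem IsSaturated.exists_stableAt_add [Fact p.Prime] (hS : IsPGroup p S)
    (hF : F.IsSaturated p) (hP : F.FullyNormalized P)
    (hX : ∀ Q : Subgroup S, Nat.card P < Nat.card Q → F.StableAt X Q) :
    ∃ k : ℕ, ¬ p ∣ k ∧ ∃ M ∈ F.cosetSpan P, F.markSum P M = 0 ∧ F.StableAt (k * X + M) P := by
  obtain ⟨k, hk, hcard⟩ := hF.exists_card_conjClass_eq_mul_index hS hP
  obtain ⟨c, hc, hsum⟩ := hF.exists_index_mul_eq_sum_mark_sub hS hP hX
  let g : F.conjClass P → ℤ := fun Q => c - k * (mark Q.1 X - mark P X)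
  have hg : ∀ (s : S) Q, g (s • Q) = g Q := fun s Q => by
    simp only [g, coe_smul_conjClass, mark_map_conj]
  have hdvd : ∀ Q : F.conjClass P,
      (Nat.card (Subgroup.normalizer (Q.1 : Set S)) : ℤ) ∣ Nat.card P * g Q := by
    intro Q
    have hQ : F.IsConj P Q.1 := mem_conjClass.1 Q.2
    rw [mul_sub, mul_left_comm]
    exact dvd_sub ((mod_cast card_dvd_card_of_isPGroup hS (hP _ hQ) :
      (Nat.card (Subgroup.normalizer (Q.1 : Set S)) : ℤ) ∣ _).trans hc)
      ((hF.card_normalizer_dvd_card_mul_mark_sub hS hP hX hQ).mul_left _)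
  obtain ⟨M, hM, hmark⟩ := exists_mem_cosetSpan_mark_eq hg hdvd
  have hsum_zero : F.markSum P M = 0 := by
    rw [markSum_apply, ← Finset.sum_coe_sort, Finset.sum_congr rfl fun Q _ => hmark Q,
      Finset.sum_sub_distrib, ← Finset.mul_sum, ← hsum, Finset.sum_const, Finset.card_univ,
      Fintype.card_coe, hcard, nsmul_eq_mul]
    push_cast
    ring
  have hval : ∀ Q, F.IsConj P Q → mark Q (k * X + M) = k * mark P X + c := by
    intro Q hQ
    rw [map_add, map_mul, map_natCast, hmark ⟨Q, mem_conjClass.2 hQ⟩]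
    ring
  exact ⟨k, hk, M, hM, hsum_zero, fun Q hQ => (hval Q hQ).trans (hval P (.refl P)).symm⟩

variable (F p) in
/-- Up to a factor prime to `p`, the marks of `X` and `Y` have the same sums (hence the same
averages) over all conjugacy classes. -/
def SameAverages (X Y : BurnsideRing S) : Prop :=
  ∃ k : ℕ, ¬ p ∣ k ∧ ∀ Q, F.markSum Q Y = k * F.markSum Q X

theorem SameAverages.refl [Fact p.Prime] (X : BurnsideRing S) : F.SameAverages p X X :=
  ⟨1, (Fact.out : p.Prime).not_dvd_one, fun Q => by rw [Nat.cast_one, one_mul]⟩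

theorem SameAverages.trans [Fact p.Prime] (hXY : F.SameAverages p X Y)
    (hYZ : F.SameAverages p Y Z) : F.SameAverages p X Z := by
  obtain ⟨k, hk, hX⟩ := hXY
  obtain ⟨l, hl, hY⟩ := hYZ
  exact ⟨l * k, (Fact.out : p.Prime).not_dvd_mul hl hk, fun Q => by
    rw [hY, hX, Nat.cast_mul, mul_assoc]⟩

theorem IsSaturated.exists_sameAverages_stableAt [Fact p.Prime] (hS : IsPGroup p S)
    (hF : F.IsSaturated p) (P : Subgroup S)
    (hX : ∀ Q : Subgroup S, Nat.card P < Nat.card Q → F.StableAt X Q) :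
    ∃ Y, F.SameAverages p X Y ∧ F.StableAt Y P ∧
      ∀ Q : Subgroup S, Nat.card P ≤ Nat.card Q → F.StableAt X Q → F.StableAt Y Q := by
  obtain ⟨R, hPR, hR⟩ := F.exists_fullyNormalized P
  rw [hPR.card_eq] at hX ⊢
  obtain ⟨k, hk, M, hM, hsum, hstable⟩ := hF.exists_stableAt_add hS hR hX
  refine ⟨k * X + M, ⟨k, hk, fun Q => ?_⟩, hstable.of_isConj hPR.symm, fun Q hQ hXQ => ?_⟩
  · rw [map_add, markSum_eq_zero_of_mem_cosetSpan hM hsum, add_zero, ← nsmul_eq_mul, map_nsmul,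
      nsmul_eq_mul]
  by_cases hRQ : F.IsConj R Q
  · exact hstable.of_isConj hRQ
  have hmark : ∀ T, F.IsConj Q T → mark T (k * X + M) = k * mark T X := by
    intro T hT
    rw [map_add, map_mul, map_natCast, mark_eq_zero_of_mem_cosetSpan hM
      (fun h => hRQ (h.trans hT.symm)) (hQ.trans hT.card_eq.le), add_zero]
  intro T hT
  rw [hmark T hT, hmark Q (.refl Q), hXQ T hT]

/-- Make `X` stable at one subgroup after another, in order of decreasing cardinality. -/
theorem IsSaturated.exists_mem_burnside_sameAverages [Fact p.Prime] (hS : IsPGroup p S)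
    (hF : F.IsSaturated p) (X : BurnsideRing S) :
    ∃ Y ∈ F.burnside, F.SameAverages p X Y := by
  classical
  have := Fintype.ofFinite (Subgroup S)
  suffices h : ∀ s : Finset (Subgroup S),
      (∀ P ∈ s, ∀ Q : Subgroup S, Nat.card P < Nat.card Q → Q ∈ s) →
        ∃ Y, F.SameAverages p X Y ∧ ∀ Q ∈ s, F.StableAt Y Q by
    obtain ⟨Y, hXY, hY⟩ := h Finset.univ fun _ _ _ _ => Finset.mem_univ _
    exact ⟨Y, mem_burnside_iff.2 fun Q => hY Q (Finset.mem_univ Q), hXY⟩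
  intro s
  induction s using Finset.induction_on_min_value (fun P : Subgroup S => Nat.card P) with
  | empty => exact fun _ => ⟨X, .refl X, fun _ h => absurd h (Finset.notMem_empty _)⟩
  | insert P s _ hmin ih =>
    intro hs
    have hlarger : ∀ T ∈ insert P s, ∀ Q : Subgroup S, Nat.card T < Nat.card Q → Q ∈ s := by
      intro T hT Q hTQ
      have hPT : Nat.card P ≤ Nat.card T := (Finset.mem_insert.1 hT).elim (fun h => h ▸ le_rfl)
        (hmin T)
      exact Finset.mem_of_mem_insert_of_ne (hs T hT Q hTQ)
        fun h => (hPT.trans_lt hTQ).ne (h ▸ rfl)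
    obtain ⟨Y, hXY, hY⟩ := ih fun T hT => hlarger T (Finset.mem_insert_of_mem hT)
    obtain ⟨Z, hYZ, hP, hZ⟩ := hF.exists_sameAverages_stableAt hS P
      fun Q hQ => hY Q (hlarger P (Finset.mem_insert_self P s) Q hQ)
    refine ⟨Z, hXY.trans hYZ, fun Q hQ => ?_⟩
    obtain rfl | hQs := Finset.mem_insert.1 hQ
    · exact hP
    · exact hZ Q (hmin Q hQs) (hY Q hQs)

end FusionSystem

/-! ### The projection onto the stable elements -/

namespace FusionSystem

open BurnsideRing

variable {S : Type u} [Group S] {F : FusionSystem S} {P Q : Subgroup S} {p : ℕ}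

theorem intCast_ne_zero_of_not_dvd {n : ℤ} (hn : ¬ (p : ℤ) ∣ n) : (n : ℚ) ≠ 0 :=
  Int.cast_ne_zero.2 fun h => hn (h ▸ dvd_zero _)

variable [Fact p.Prime] {X A : PLocal p (BurnsideRing S)}

theorem mem_pBurnside_iff : X ∈ F.pBurnside p ↔ ∃ (n : ℤ) (Y : BurnsideRing S),
    ¬ (p : ℤ) ∣ n ∧ Y ∈ F.burnside ∧ (n : PLocal p (BurnsideRing S)) * X = algebraMap _ _ Y := by
  constructor
  · rintro ⟨Z, rfl⟩
    obtain ⟨n, Y, hn, hY⟩ := PLocal.exists_intCast_mul_eq_algebraMap p Z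
    refine ⟨n, Y, hn, Y.2, ?_⟩
    rw [← map_intCast (PLocal.map p F.burnside.subtype), ← map_mul, hY, PLocal.map_algebraMap,
      Subring.subtype_apply]
  · rintro ⟨n, Y, hn, hY, h⟩
    obtain ⟨Z, hZ⟩ := (PLocal.isUnit_intCast p hn).dvd
      (a := algebraMap F.burnside (PLocal p F.burnside) ⟨Y, hY⟩)
    refine ⟨Z, (PLocal.isUnit_intCast p hn).mul_left_cancel ?_⟩
    rw [h, ← map_intCast (PLocal.map p F.burnside.subtype), ← map_mul, ← hZ,
      PLocal.map_algebraMap, Subring.subtype_apply]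

theorem IsConj.pMark_eq (h : F.IsConj P Q) (hX : X ∈ F.pBurnside p) :
    pMark p Q X = pMark p P X := by
  obtain ⟨n, Y, hn, hY, hXY⟩ := mem_pBurnside_iff.1 hX
  have hmark : ∀ R, (n : ℚ) * pMark p R X = mark R Y := fun R => by
    rw [← pMark_algebraMap p, ← hXY, map_mul, map_intCast]
  refine mul_left_cancel₀ (intCast_ne_zero_of_not_dvd hn) ?_
  rw [hmark, hmark, mem_burnside_iff.1 hY P Q h]

variable [Finite S]

variable (F p) in
/-- The average of the marks of `X` over the conjugacy class of `Q`. -/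
noncomputable def averageMark (Q : Subgroup S) (X : PLocal p (BurnsideRing S)) : ℚ :=
  1 / ((F.conjClass Q).card : ℚ) * ∑ Q' ∈ F.conjClass Q, pMark p Q' X

theorem averageMark_algebraMap (Q : Subgroup S) (X : BurnsideRing S) :
    F.averageMark p Q (algebraMap _ _ X) = 1 / ((F.conjClass Q).card : ℚ) * F.markSum Q X := by
  simp only [averageMark, pMark_algebraMap, markSum_apply, Int.cast_sum]

theorem averageMark_add (Q : Subgroup S) (X Y : PLocal p (BurnsideRing S)) :
    F.averageMark p Q (X + Y) = F.averageMark p Q X + F.averageMark p Q Y := by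
  simp only [averageMark, map_add, Finset.sum_add_distrib, mul_add]

theorem averageMark_mul (Q : Subgroup S) (hA : A ∈ F.pBurnside p)
    (X : PLocal p (BurnsideRing S)) :
    F.averageMark p Q (A * X) = pMark p Q A * F.averageMark p Q X := by
  have hterm : ∀ Q' ∈ F.conjClass Q, pMark p Q' (A * X) = pMark p Q A * pMark p Q' X :=
    fun Q' hQ' => by rw [map_mul, (mem_conjClass.1 hQ').pMark_eq hA]
  rw [averageMark, Finset.sum_congr rfl hterm, ← Finset.mul_sum, averageMark, mul_left_comm]

theorem averageMark_eq_pMark (Q : Subgroup S) (hA : A ∈ F.pBurnside p) :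
    F.averageMark p Q A = pMark p Q A := by
  have hcard : ((F.conjClass Q).card : ℚ) ≠ 0 := mod_cast (card_conjClass_pos Q).ne'
  rw [averageMark, Finset.sum_congr rfl fun Q' hQ' => (mem_conjClass.1 hQ').pMark_eq hA,
    Finset.sum_const, nsmul_eq_mul, one_div, inv_mul_cancel_left₀ hcard]

theorem averageMark_intCast_mul (Q : Subgroup S) (n : ℤ) (X : PLocal p (BurnsideRing S)) :
    F.averageMark p Q (n * X) = n * F.averageMark p Q X := by
  rw [averageMark_mul Q (intCast_mem _ n), map_intCast]

theorem IsSaturated.exists_pMark_eq_averageMark (hS : IsPGroup p S) (hF : F.IsSaturated p)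
    (X : PLocal p (BurnsideRing S)) :
    ∃ Y : F.pBurnside p, ∀ Q, pMark p Q (Y : PLocal p (BurnsideRing S)) = F.averageMark p Q X := by
  obtain ⟨n, Z, hn, hZ⟩ := PLocal.exists_intCast_mul_eq_algebraMap p X
  obtain ⟨Y, hY, k, hk, hsum⟩ := hF.exists_mem_burnside_sameAverages hS Z
  have hkn : ¬ (p : ℤ) ∣ k * n :=
    (Nat.prime_iff_prime_int.1 Fact.out).not_dvd_mul (mod_cast hk) hn
  obtain ⟨W, hW⟩ := (PLocal.isUnit_intCast p hkn).dvd
    (a := algebraMap (BurnsideRing S) (PLocal p (BurnsideRing S)) Y)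
  have hW_mem : W ∈ F.pBurnside p := mem_pBurnside_iff.2 ⟨k * n, Y, hkn, hY, hW.symm⟩
  refine ⟨⟨W, hW_mem⟩, fun Q => mul_left_cancel₀ (intCast_ne_zero_of_not_dvd hkn) ?_⟩
  calc ((k * n : ℤ) : ℚ) * pMark p Q W
      = F.averageMark p Q (algebraMap _ _ Y) := by
        rw [← averageMark_eq_pMark Q hW_mem, ← averageMark_intCast_mul, hW]
    _ = k * F.averageMark p Q (algebraMap _ _ Z) := by
        rw [averageMark_algebraMap, averageMark_algebraMap, hsum]
        push_cast
        ring
    _ = ((k * n : ℤ) : ℚ) * F.averageMark p Q X := by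
        rw [← hZ, averageMark_intCast_mul]
        push_cast
        ring

/-- The map `π : A(S)_(p) → A(F)_(p)` that averages the marks over conjugacy classes. -/
noncomputable def projection (hS : IsPGroup p S) (hF : F.IsSaturated p) :
    PLocal p (BurnsideRing S) →ₗ[F.pBurnside p] F.pBurnside p :=
  haveI h := fun X => (hF.exists_pMark_eq_averageMark hS X).choose_spec
  { toFun X := (hF.exists_pMark_eq_averageMark hS X).choose
    map_add' X Y := Subtype.ext <| ext_pMark p fun Q => by
      rw [Subring.coe_add, map_add, h, h, h, averageMark_add]
    map_smul' A X := Subtype.ext <| ext_pMark p fun Q => by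
      rw [RingHom.id_apply, smul_eq_mul, Subring.coe_mul, map_mul, h, h]
      exact averageMark_mul Q A.2 X }

theorem pMark_projection (hS : IsPGroup p S) (hF : F.IsSaturated p)
    (X : PLocal p (BurnsideRing S)) (Q : Subgroup S) :
    pMark p Q (projection hS hF X : PLocal p (BurnsideRing S)) = F.averageMark p Q X :=
  (hF.exists_pMark_eq_averageMark hS X).choose_spec Q

end FusionSystem

theorem theoremA (p : ℕ) [Fact p.Prime] (S : Type u) [Group S] [Finite S] (hS : IsPGroup p S)
    (F : FusionSystem S) (hF : F.IsSaturated p) :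
    ∃ π : PLocal p (BurnsideRing S) →ₗ[F.pBurnside p] F.pBurnside p,
      (∀ (X : PLocal p (BurnsideRing S)) (Q : Subgroup S),
        BurnsideRing.pMark p Q (π X : PLocal p (BurnsideRing S)) =
          1 / ((F.conjClass Q).card : ℚ) *
            ∑ Q' ∈ F.conjClass Q, BurnsideRing.pMark p Q' X) ∧
      (∀ X Y : PLocal p (BurnsideRing S),
        (∀ Q : Subgroup S, BurnsideRing.pMark p Q Y =
          1 / ((F.conjClass Q).card : ℚ) *
            ∑ Q' ∈ F.conjClass Q, BurnsideRing.pMark p Q' X) →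
        Y = (π X : PLocal p (BurnsideRing S))) ∧
      ∀ Y : F.pBurnside p, π (Y : PLocal p (BurnsideRing S)) = Y := by
  have hmark := FusionSystem.pMark_projection hS hF
  refine ⟨FusionSystem.projection hS hF, hmark, fun X Y h => ?_, fun Y => Subtype.ext ?_⟩
  · exact BurnsideRing.ext_pMark p fun Q => (h Q).trans (hmark X Q).symm
  · exact BurnsideRing.ext_pMark p fun Q =>
      (hmark Y Q).trans (FusionSystem.averageMark_eq_pMark Q Y.2)
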